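/- Let $m\ge 1$, $c>0$, $s\in\mathbb{R}_{>0}^m$ and $$\mathcal Z=\{z\in[0,1]^m : \|z\|_1\le 1,\ c\,z\le s \text{ coordinatewise}\}.$$ Let $U:\mathcal Z\to[0,1]$ be differentiable, strictly increasing ($U(x)<U(y)$ whenever $x_j<y_j$ for all $j$), concave and $\beta$-smooth (its gradient is $\beta$-Lipschitz on $\mathcal Z$ for the Euclidean norm), with $U(0)=0$ and $U(z)>0$ for some $z\in\mathcal Z$. Let $\upsilon>0$ and $\theta(x)=\log(U(x)+\upsilon)$, and suppose that $\nabla\theta$ is $L$-Lipschitz on $\mathcal Z$. Let $\rho>0$, $\xi>0$ and $z,\gamma\in\mathbb{R}^m$ be arbitrary. Then a single point $x^*\in\mathcal Z$ that satisfies $$(x-x^*)^T\bigl(\nabla\theta(x^*)-\gamma-\rho(x^*-z)\bigr)\le \xi\qquad\text{for all } x\in\mathcal Z$$ (so that $x^*$ is a $\xi$-approximate first-order maximizer over $\mathcal Z$ of the augmented Lagrangian $\theta(x)-\gamma^T(x-z)-\frac{\rho}{2}\|x-z\|_2^2$) can be computed in time $$\mathcal O\!\left(m\log(m)\,\sqrt{\frac{L+\rho}{\xi}}\;\log(1/\xi)\right),$$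 where each of the three factors $\log m$, $\sqrt{(L+\rho)/\xi}$ and $\log(1/\xi)$ is read as at least $1$, i.e. as $\max(1,\cdot)$. Here time is the number of steps of a real RAM (unit-cost real arithmetic $+,-,\times,\div$ and comparisons, unit-cost integer index arithmetic and array access) that has access to $\nabla\theta$ on $\mathcal Z$ through an oracle. More precisely: there is one program, independent of all data, which is given $m,s,z,\gamma,c,\rho,\xi$ and the oracle (but not $L$, $\beta$ or $\upsilon$), and for every $\kappa$ there is a constant $C=C(\kappa)$ such that, whenever one evaluation of $\nabla\theta$ takes time at most $\kappa\, m\max(1,\log m)$ (plus $m$ steps for the transfer of the coordinates), the program outputs such an $x^*$ in time at most $$C\,m\max(1,\log m)\cdot\max\Bigl(1,\sqrt{(L+\rho)/\xi}\Bigr)\cdot\max\bigl(1,\log(1/\xi)\bigr).$$ -/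

import Mathlib

/-! ### The allocation problem -/

noncomputable section

/-- The set of feasible allocations `{z ∈ [0,1]^m : ‖z‖₁ ≤ 1, c z ≤ s}`. -/
def feasibleSet {m : ℕ} (c : ℝ) (s : EuclideanSpace ℝ (Fin m)) :
    Set (EuclideanSpace ℝ (Fin m)) :=
  {z | (∀ j, 0 ≤ z j ∧ z j ≤ 1) ∧ ∑ j, |z j| ≤ 1 ∧ ∀ j, c * z j ≤ s j}

/-- The class of utility functions on a set `Z` of allocations: differentiable, strictly increasing,
concave, `β`-smooth, with values in `[0,1]`, zero at the origin and positive somewhere.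
Only the values of `U` on `Z` matter; gradients are taken relative to `Z`. -/
structure IsUtility {m : ℕ} (Z : Set (EuclideanSpace ℝ (Fin m))) (β : ℝ)
    (U : EuclideanSpace ℝ (Fin m) → ℝ) : Prop where
  differentiableOn : DifferentiableOn ℝ U Z
  strictIncr : ∀ x ∈ Z, ∀ y ∈ Z, (∀ j, x j < y j) → U x < U y
  concaveOn : ConcaveOn ℝ Z U
  smooth : ∀ x ∈ Z, ∀ y ∈ Z,
    ‖gradientWithin U Z x - gradientWithin U Z y‖ ≤ β * ‖x - y‖
  mem_Icc : ∀ x ∈ Z, 0 ≤ U x ∧ U x ≤ 1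
  map_zero : U 0 = 0
  exists_pos : ∃ x ∈ Z, 0 < U x

/-- The smoothed logarithmic utility `θ(x) = log (U(x) + υ)`. -/
def smoothedLog {m : ℕ} (U : EuclideanSpace ℝ (Fin m) → ℝ) (υ : ℝ)
    (x : EuclideanSpace ℝ (Fin m)) : ℝ :=
  Real.log (U x + υ)

/-! ### A real RAM with a gradient oracle

A program is a finite text over finitely many integer registers and finitely many real arrays
with indirect addressing.  Arithmetic operations, comparisons, assignments and array accesses
take unit time.  There are no square roots, logarithms, roundings of reals, or integer products. -/

namespace RealRAM

/-- A memory state: integer registers, and arrays of real numbers (`arr a i` is cell `i` of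
array `a`). -/
structure State where
  reg : ℕ → ℕ
  arr : ℕ → ℕ → ℝ

/-- Integer expressions. -/
inductive NExpr : Type
  | lit (k : ℕ)
  | reg (r : ℕ)
  | add (e f : NExpr)
  | sub (e f : NExpr)
  | half (e : NExpr)

/-- Real expressions; the literals are rational. -/
inductive RExpr : Type
  | lit (q : ℚ)
  | ofNat (e : NExpr)
  | get (a : ℕ) (i : NExpr)
  | add (e f : RExpr)
  | sub (e f : RExpr)
  | mul (e f : RExpr)
  | div (e f : RExpr)

/-- Tests. -/
inductive BExpr : Type
  | natLt (e f : NExpr)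
  | realLe (e f : RExpr)
  | not (b : BExpr)
  | and (b b' : BExpr)

def NExpr.eval (σ : State) : NExpr → ℕ
  | lit k => k
  | reg r => σ.reg r
  | add e f => e.eval σ + f.eval σ
  | sub e f => e.eval σ - f.eval σ
  | half e => e.eval σ / 2

def RExpr.eval (σ : State) : RExpr → ℝ
  | lit q => (q : ℝ)
  | ofNat e => (e.eval σ : ℝ)
  | get a i => σ.arr a (i.eval σ)
  | add e f => e.eval σ + f.eval σ
  | sub e f => e.eval σ - f.eval σ
  | mul e f => e.eval σ * f.eval σ
  | div e f => e.eval σ / f.eval σ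

def BExpr.Holds (σ : State) : BExpr → Prop
  | natLt e f => e.eval σ < f.eval σ
  | realLe e f => e.eval σ ≤ f.eval σ
  | not b => ¬ b.Holds σ
  | and b b' => b.Holds σ ∧ b'.Holds σ

/-- The time to evaluate an expression: one unit per node. -/
def NExpr.cost : NExpr → ℕ
  | lit _ => 1
  | reg _ => 1
  | add e f => e.cost + f.cost + 1
  | sub e f => e.cost + f.cost + 1
  | half e => e.cost + 1

def RExpr.cost : RExpr → ℕ
  | lit _ => 1
  | ofNat e => e.cost + 1
  | get _ i => i.cost + 1
  | add e f => e.cost + f.cost + 1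
  | sub e f => e.cost + f.cost + 1
  | mul e f => e.cost + f.cost + 1
  | div e f => e.cost + f.cost + 1

def BExpr.cost : BExpr → ℕ
  | natLt e f => e.cost + f.cost + 1
  | realLe e f => e.cost + f.cost + 1
  | not b => b.cost + 1
  | and b b' => b.cost + b'.cost + 1

/-- Programs. -/
inductive Cmd : Type
  | skip
  /-- `reg[r] := e` -/
  | setReg (r : ℕ) (e : NExpr)
  /-- `arr[a][i] := e` -/
  | setCell (a : ℕ) (i : NExpr) (e : RExpr)
  /-- query the oracle at the vector stored in array `src`; write the answer to array `dst` -/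
  | oracle (dst src : ℕ)
  | seq (p q : Cmd)
  | ite (b : BExpr) (p q : Cmd)
  | while (b : BExpr) (p : Cmd)

def State.setReg (σ : State) (r v : ℕ) : State :=
  { σ with reg := Function.update σ.reg r v }

def State.setCell (σ : State) (a i : ℕ) (v : ℝ) : State :=
  { σ with arr := Function.update σ.arr a (Function.update (σ.arr a) i v) }

/-- The vector stored in the first `m` cells of array `a`. -/
def State.vec (σ : State) (m a : ℕ) : EuclideanSpace ℝ (Fin m) :=
  WithLp.toLp 2 (fun j : Fin m => σ.arr a j)

/-- Overwrite the first `m` cells of array `a` by `v`. -/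
def State.setVec {m : ℕ} (σ : State) (a : ℕ) (v : EuclideanSpace ℝ (Fin m)) : State :=
  let cells : ℕ → ℝ := fun i => if h : i < m then v ⟨i, h⟩ else σ.arr a i
  { σ with arr := Function.update σ.arr a cells }

/-- `Exec G τ p σ σ' t`: with the oracle `G`, the program `p` started in the state `σ` halts in
the state `σ'` after time `t`.  An oracle call takes time `τ`, plus `m` for the transfer of the
`m` coordinates. -/
inductive Exec {m : ℕ} (G : EuclideanSpace ℝ (Fin m) → EuclideanSpace ℝ (Fin m)) (τ : ℕ) :
    Cmd → State → State → ℕ → Prop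
  | skip (σ : State) : Exec G τ .skip σ σ 1
  | setReg (σ : State) (r : ℕ) (e : NExpr) :
      Exec G τ (.setReg r e) σ (σ.setReg r (e.eval σ)) (e.cost + 1)
  | setCell (σ : State) (a : ℕ) (i : NExpr) (e : RExpr) :
      Exec G τ (.setCell a i e) σ (σ.setCell a (i.eval σ) (e.eval σ)) (i.cost + e.cost + 1)
  | oracle (σ : State) (dst src : ℕ) :
      Exec G τ (.oracle dst src) σ (σ.setVec dst (G (σ.vec m src))) (m + τ)
  | seq {p q : Cmd} {σ σ' σ'' : State} {t t' : ℕ} :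
      Exec G τ p σ σ' t → Exec G τ q σ' σ'' t' → Exec G τ (.seq p q) σ σ'' (t + t')
  | ite_true {b : BExpr} {p q : Cmd} {σ σ' : State} {t : ℕ} :
      b.Holds σ → Exec G τ p σ σ' t → Exec G τ (.ite b p q) σ σ' (b.cost + t)
  | ite_false {b : BExpr} {p q : Cmd} {σ σ' : State} {t : ℕ} :
      ¬ b.Holds σ → Exec G τ q σ σ' t → Exec G τ (.ite b p q) σ σ' (b.cost + t)
  | while_false {b : BExpr} {p : Cmd} {σ : State} :
      ¬ b.Holds σ → Exec G τ (.while b p) σ σ b.cost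
  | while_true {b : BExpr} {p : Cmd} {σ σ' σ'' : State} {t t' : ℕ} :
      b.Holds σ → Exec G τ p σ σ' t → Exec G τ (.while b p) σ' σ'' t' →
      Exec G τ (.while b p) σ σ'' (b.cost + t + t')

/-- The initial state for the `x`-update: register `0` holds `m`, arrays `0`, `1`, `2` hold the
vectors `s`, `z`, `γ`, array `3` holds `c`, `ρ`, `ξ`; everything else is zero. -/
def initState {m : ℕ} (c : ℝ) (s : EuclideanSpace ℝ (Fin m)) (ρ : ℝ)
    (z γ : EuclideanSpace ℝ (Fin m)) (ξ : ℝ) : State :=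
  let blank : State := { reg := fun _ => 0, arr := fun _ _ => 0 }
  let vectors : State := (((blank.setReg 0 m).setVec 0 s).setVec 1 z).setVec 2 γ
  ((vectors.setCell 3 0 c).setCell 3 1 ρ).setCell 3 2 ξ

/-- The output vector is read from array `4`. -/
def State.output (σ : State) (m : ℕ) : EuclideanSpace ℝ (Fin m) := σ.vec m 4

end RealRAM

end

/-! The negated augmented Lagrangian is convex on the feasible set, and its gradient `objectiveGrad`
is Lipschitz with constant `L + ρ`: the logarithm is concave and increasing, so `θ` is concave, and
the penalty adds `ρ`. What is sought is a point whose variational inequality gap is at most `ξ`,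
which is stronger than a small function value.

Certificate. A projected gradient step from `x` to `x'` with step size `1 / M` has the residual `r =
g x' - g x + M (x - x')`. By the projection inequality the gap at `x'` is at most the diameter times
`‖r‖`, whatever `M` is (`IsProj.inner_le_norm_residual`). The diameter is at most `√2`, so the
machine tests `2 ‖r‖² ≤ ξ²` without square roots.

Small residual. For `M = 4 ^ j ξ`, recursive regularization runs stages `k = 0, …, j`. Stage `k`
adds a quadratic of modulus `σ_k = 4 ^ k ξ / 16` centred at the current point and makes `N_k = 1024
· 2 ^ (j - k)` accelerated steps. Since `N_k² σ_k = 65536 M`, each stage divides the distance to the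
regularized solution by 64 (`StageInv.succ`), while the accumulated gradient of the regularizers
stays of order `ξ`. If `M ≥ L + ρ`, the test must therefore succeed (`StageInv.norm_residual_le`).

Unknown `L`. The guess `M` starts at `ξ` and is multiplied by 4 after each failed test. Both the
`N_k` within a run and the runs themselves form geometric series, so the total number of steps is of
order `√((L + ρ) / ξ)`, with no logarithm of `1 / ξ`.

Cost of a step. Apart from an oracle call and linear work, a step is one projection: subtract a
common level, clip to `[0, s_j / c]`, and choose the level by complementary slackness. The mass is
piecewise linear in the level with `2 m` breakpoints, so merge sort, binary search and one
interpolation find the level in time `O(m log m)` (`runs_project`). -/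

namespace RealRAM

/-! ### Frame conditions and total correctness with time bounds -/

/-- Whether a program contains an assignment to register `r`. -/
def Cmd.writesReg : Cmd → ℕ → Bool
  | .skip, _ => false
  | .setReg r' _, r => r == r'
  | .setCell _ _ _, _ => false
  | .oracle _ _, _ => false
  | .seq p q, r => p.writesReg r || q.writesReg r
  | .ite _ p q, r => p.writesReg r || q.writesReg r
  | .while _ p, r => p.writesReg r

/-- Whether a program contains an assignment to array `a`. -/
def Cmd.writesArr : Cmd → ℕ → Bool
  | .skip, _ => false
  | .setReg _ _, _ => false
  | .setCell a' _ _, a => a == a'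
  | .oracle dst _, a => a == dst
  | .seq p q, a => p.writesArr a || q.writesArr a
  | .ite _ p q, a => p.writesArr a || q.writesArr a
  | .while _ p, a => p.writesArr a

/-- `σ'` agrees with `σ` on everything the program `p` does not write. -/
structure Frame (p : Cmd) (σ σ' : State) : Prop where
  reg : ∀ r, p.writesReg r = false → σ'.reg r = σ.reg r
  arr : ∀ a, p.writesArr a = false → σ'.arr a = σ.arr a

variable {m : ℕ} {G : EuclideanSpace ℝ (Fin m) → EuclideanSpace ℝ (Fin m)} {τ : ℕ}

/-- Since `writesReg` and `writesArr` are computable, the side conditions of the frame rule hold by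
`rfl` for concrete programs. The later proofs use this to carry untouched data past each command. -/
theorem Exec.frame {p : Cmd} {σ σ' : State} {t : ℕ} (h : Exec G τ p σ σ' t) : Frame p σ σ' := by
  induction h with
  | skip σ => exact ⟨fun _ _ => rfl, fun _ _ => rfl⟩
  | setReg σ r e =>
    refine ⟨fun r' h => ?_, fun _ _ => rfl⟩
    simp only [Cmd.writesReg, beq_eq_false_iff_ne] at h
    simp [State.setReg, h]
  | setCell σ a i e =>
    refine ⟨fun _ _ => rfl, fun a' h => ?_⟩
    simp only [Cmd.writesArr, beq_eq_false_iff_ne] at h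
    simp [State.setCell, h]
  | oracle σ dst src =>
    refine ⟨fun _ _ => rfl, fun a' h => ?_⟩
    simp only [Cmd.writesArr, beq_eq_false_iff_ne] at h
    simp [State.setVec, h]
  | seq _ _ ih ih' =>
    refine ⟨fun r h => ?_, fun a h => ?_⟩
    · simp only [Cmd.writesReg, Bool.or_eq_false_iff] at h
      rw [ih'.reg r h.2, ih.reg r h.1]
    · simp only [Cmd.writesArr, Bool.or_eq_false_iff] at h
      rw [ih'.arr a h.2, ih.arr a h.1]
  | ite_true _ _ ih =>
    refine ⟨fun r h => ?_, fun a h => ?_⟩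
    · simp only [Cmd.writesReg, Bool.or_eq_false_iff] at h
      exact ih.reg r h.1
    · simp only [Cmd.writesArr, Bool.or_eq_false_iff] at h
      exact ih.arr a h.1
  | ite_false _ _ ih =>
    refine ⟨fun r h => ?_, fun a h => ?_⟩
    · simp only [Cmd.writesReg, Bool.or_eq_false_iff] at h
      exact ih.reg r h.2
    · simp only [Cmd.writesArr, Bool.or_eq_false_iff] at h
      exact ih.arr a h.2
  | while_false _ => exact ⟨fun _ _ => rfl, fun _ _ => rfl⟩
  | while_true _ _ _ ih ih' =>
    refine ⟨fun r h => ?_, fun a h => ?_⟩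
    · rw [ih'.reg r h, ih.reg r h]
    · rw [ih'.arr a h, ih.arr a h]

variable (G τ) in
/-- Started in `σ`, the program `p` halts within time `T` in a state satisfying `Q`. -/
def Runs (p : Cmd) (σ : State) (T : ℕ) (Q : State → Prop) : Prop :=
  ∃ σ' t, Exec G τ p σ σ' t ∧ t ≤ T ∧ Q σ'

theorem Runs.mono {p : Cmd} {σ : State} {T T' : ℕ} {Q Q' : State → Prop}
    (h : Runs G τ p σ T Q) (hT : T ≤ T') (hQ : ∀ σ', Q σ' → Q' σ') : Runs G τ p σ T' Q' := by
  obtain ⟨σ', t, he, ht, hq⟩ := h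
  exact ⟨σ', t, he, ht.trans hT, hQ _ hq⟩

theorem Runs.le {p : Cmd} {σ : State} {T T' : ℕ} {Q : State → Prop}
    (h : Runs G τ p σ T Q) (hT : T ≤ T') : Runs G τ p σ T' Q := h.mono hT fun _ h => h

theorem Runs.frame {p : Cmd} {σ : State} {T : ℕ} {Q : State → Prop}
    (h : Runs G τ p σ T Q) : Runs G τ p σ T (fun σ' => Q σ' ∧ Frame p σ σ') := by
  obtain ⟨σ', t, he, ht, hq⟩ := h
  exact ⟨σ', t, he, ht, hq, he.frame⟩

theorem Runs.skip {σ : State} {Q : State → Prop} (h : Q σ) : Runs G τ .skip σ 1 Q :=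
  ⟨σ, 1, .skip σ, le_rfl, h⟩

theorem Runs.setReg {r : ℕ} {e : NExpr} {σ : State} {Q : State → Prop}
    (h : Q (σ.setReg r (e.eval σ))) : Runs G τ (.setReg r e) σ (e.cost + 1) Q :=
  ⟨_, _, .setReg σ r e, le_rfl, h⟩

theorem Runs.setCell {a : ℕ} {i : NExpr} {e : RExpr} {σ : State} {Q : State → Prop}
    (h : Q (σ.setCell a (i.eval σ) (e.eval σ))) :
    Runs G τ (.setCell a i e) σ (i.cost + e.cost + 1) Q :=
  ⟨_, _, .setCell σ a i e, le_rfl, h⟩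

theorem Runs.oracle {dst src : ℕ} {σ : State} {Q : State → Prop}
    (h : Q (σ.setVec dst (G (σ.vec m src)))) : Runs G τ (.oracle dst src) σ (m + τ) Q :=
  ⟨_, _, .oracle σ dst src, le_rfl, h⟩

theorem Runs.seq {p q : Cmd} {σ : State} {T T' : ℕ} {Q R : State → Prop}
    (hp : Runs G τ p σ T R) (hq : ∀ σ', R σ' → Runs G τ q σ' T' Q) :
    Runs G τ (.seq p q) σ (T + T') Q := by
  obtain ⟨σ', t, he, ht, hr⟩ := hp
  obtain ⟨σ'', t', he', ht', hq'⟩ := hq σ' hr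
  exact ⟨σ'', _, .seq he he', add_le_add ht ht', hq'⟩

theorem Runs.setReg_seq {r : ℕ} {e : NExpr} {q : Cmd} {σ : State} {T : ℕ} {Q : State → Prop}
    (h : Runs G τ q (σ.setReg r (e.eval σ)) T Q) :
    Runs G τ (.seq (.setReg r e) q) σ (e.cost + 1 + T) Q :=
  (Runs.setReg (Q := fun σ' => σ' = σ.setReg r (e.eval σ)) rfl).seq fun _ h' => h' ▸ h

theorem Runs.setCell_seq {a : ℕ} {i : NExpr} {e : RExpr} {q : Cmd} {σ : State} {T : ℕ}
    {Q : State → Prop} (h : Runs G τ q (σ.setCell a (i.eval σ) (e.eval σ)) T Q) :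
    Runs G τ (.seq (.setCell a i e) q) σ (i.cost + e.cost + 1 + T) Q :=
  (Runs.setCell (Q := fun σ' => σ' = σ.setCell a (i.eval σ) (e.eval σ)) rfl).seq
    fun _ h' => h' ▸ h

theorem Runs.ite {b : BExpr} {p q : Cmd} {σ : State} {T : ℕ} {Q : State → Prop}
    (hp : b.Holds σ → Runs G τ p σ T Q) (hq : ¬ b.Holds σ → Runs G τ q σ T Q) :
    Runs G τ (.ite b p q) σ (b.cost + T) Q := by
  by_cases hb : b.Holds σ
  · obtain ⟨σ', t, he, ht, h⟩ := hp hb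
    exact ⟨σ', _, .ite_true hb he, by lia, h⟩
  · obtain ⟨σ', t, he, ht, h⟩ := hq hb
    exact ⟨σ', _, .ite_false hb he, by lia, h⟩

/-- The loop rule: each round is paid for by the decrease of a potential `Φ`. -/
theorem Runs.while_potential {b : BExpr} {p : Cmd} {σ : State} (I : State → Prop)
    (Φ : State → ℕ)
    (step : ∀ σ, I σ → b.Holds σ →
      ∃ T, Runs G τ p σ T (fun σ' => I σ' ∧ Φ σ' + T + b.cost ≤ Φ σ))
    (h : I σ) :
    Runs G τ (.while b p) σ (Φ σ + b.cost) (fun σ' => I σ' ∧ ¬ b.Holds σ') := by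
  -- A round pays at least for its test, so the potential drops strictly even if `T = 0`; the
  -- induction on `Φ` relies on this.
  have hc : 0 < b.cost := by cases b <;> simp [BExpr.cost]
  induction hn : Φ σ using Nat.strong_induction_on generalizing σ with
  | _ n ih =>
    by_cases hb : b.Holds σ
    · obtain ⟨T, σ', t, he, ht, hi, hΦ⟩ := step σ h hb
      obtain ⟨σ'', t', he', ht', hq⟩ := ih (Φ σ') (by lia) hi rfl
      exact ⟨σ'', _, .while_true hb he he', by lia, hq⟩
    · exact ⟨σ, _, .while_false hb, by lia, h, hb⟩

/-- The loop rule with a bound `n` on the number of rounds. -/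
theorem Runs.while_variant {b : BExpr} {p : Cmd} {σ : State} {T n : ℕ} (I : State → Prop)
    (V : State → ℕ)
    (step : ∀ σ, I σ → b.Holds σ → Runs G τ p σ T (fun σ' => I σ' ∧ V σ' < V σ))
    (h : I σ) (hn : V σ ≤ n) :
    Runs G τ (.while b p) σ (n * (T + b.cost) + b.cost) (fun σ' => I σ' ∧ ¬ b.Holds σ') := by
  refine (Runs.while_potential I (fun σ => V σ * (T + b.cost)) (fun σ hI hb => ⟨T, ?_⟩) h).le
    (by gcongr)
  refine (step σ hI hb).mono le_rfl fun σ' h' => ⟨h'.1, ?_⟩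
  have : (V σ' + 1) * (T + b.cost) ≤ V σ * (T + b.cost) := Nat.mul_le_mul_right _ h'.2
  lia

/-- `for i < n do body`. -/
def forLoop (i n : ℕ) (body : Cmd) : Cmd :=
  .seq (.setReg i (.lit 0)) (.while (.natLt (.reg i) (.reg n))
    (.seq body (.setReg i (.add (.reg i) (.lit 1)))))

theorem runs_forLoop {i n : ℕ} {body : Cmd} {σ : State} {T : ℕ} (I : ℕ → State → Prop)
    (hin : i ≠ n) (hi : body.writesReg i = false) (hn : body.writesReg n = false)
    (h0 : I 0 (σ.setReg i 0))
    (step : ∀ k < σ.reg n, ∀ σ', I k σ' → σ'.reg i = k →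
      Runs G τ body σ' T (fun σ'' => I (k + 1) (σ''.setReg i (k + 1)))) :
    Runs G τ (forLoop i n body) σ (σ.reg n * (T + 7) + 5) (fun σ' => I (σ.reg n) σ') := by
  have key := Runs.while_variant (G := G) (τ := τ) (σ := σ.setReg i 0) (T := T + 4)
    (n := σ.reg n) (b := .natLt (.reg i) (.reg n))
    (p := .seq body (.setReg i (.add (.reg i) (.lit 1))))
    (fun σ' => σ'.reg n = σ.reg n ∧ σ'.reg i ≤ σ.reg n ∧ I (σ'.reg i) σ')
    (fun σ' => σ.reg n - σ'.reg i) ?_ ?_ (by simp)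
  · refine (Runs.setReg_seq (T := σ.reg n * (T + 4 + 3) + 3) ?_).le ?_
    · refine key.mono le_rfl ?_
      rintro σ' ⟨⟨h1, h2, h3⟩, h4⟩
      simp only [BExpr.Holds, NExpr.eval] at h4
      have : σ'.reg i = σ.reg n := by lia
      rwa [this] at h3
    · simp only [NExpr.cost]; lia
  · rintro σ' ⟨h1, h2, h3⟩ hb
    simp only [BExpr.Holds, NExpr.eval] at hb
    refine (step (σ'.reg i) (by lia) σ' h3 rfl).frame.seq (T' := 4) fun σ'' h => ?_
    refine Runs.setReg ?_
    obtain ⟨hI, hf⟩ := h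
    have e1 := hf.reg i hi
    have e2 := hf.reg n hn
    simp only [NExpr.eval, State.setReg, Function.update_self, ne_eq, Ne.symm hin,
      not_false_eq_true, Function.update_of_ne, e1, e2] at hI ⊢
    exact ⟨⟨h1, by lia, hI⟩, by lia⟩
  · simp [State.setReg, Ne.symm hin]
    simpa [State.setReg] using h0

/-- `for i < n do arr[a][i] := e`. -/
def fillLoop (i n a : ℕ) (e : RExpr) : Cmd := forLoop i n (.setCell a (.reg i) e)

/-- An elementwise assignment to an array, where `e` may read the entry that it overwrites. -/
theorem runs_fillLoop {i n a : ℕ} {e : RExpr} {σ : State} (v : ℕ → ℝ) (hin : i ≠ n)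
    (he : ∀ k < σ.reg n, ∀ w : ℕ → ℝ, w k = σ.arr a k →
      e.eval ⟨Function.update σ.reg i k, Function.update σ.arr a w⟩ = v k) :
    Runs G τ (fillLoop i n a e) σ (σ.reg n * (e.cost + 9) + 5)
      (fun σ' => ∀ k < σ.reg n, σ'.arr a k = v k) := by
  -- The invariant fixes the whole state: only the counter and array `a` have changed, and the
  -- entries from `k` on are still the original ones, so `e` may read the cell about to be
  -- overwritten.
  have := runs_forLoop (G := G) (τ := τ) (i := i) (n := n) (σ := σ)
    (body := .setCell a (.reg i) e) (T := e.cost + 2)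
    (fun k σ' => (∃ w, σ' = ⟨Function.update σ.reg i k, Function.update σ.arr a w⟩ ∧
      (∀ l, k ≤ l → w l = σ.arr a l) ∧ ∀ l < k, w l = v l)) hin rfl rfl ?_ ?_
  · refine this.mono (by lia) ?_
    rintro σ' ⟨w, rfl, _, h⟩ k hk
    simpa using h k hk
  · exact ⟨σ.arr a, by simp [State.setReg], fun _ _ => rfl, by simp⟩
  · rintro k hk σ' ⟨w, rfl, h1, h2⟩ -
    refine (Runs.setCell ?_).le (by simp only [NExpr.cost]; lia)
    refine ⟨Function.update w k (v k), ?_, ?_, ?_⟩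
    · rw [he k hk w (h1 k le_rfl)]
      simp [State.setCell, State.setReg, NExpr.eval]
    · intro l hl
      rw [Function.update_of_ne (by lia)]
      exact h1 l (by lia)
    · intro l hl
      rcases Nat.lt_succ_iff_lt_or_eq.mp hl with h | rfl
      · rw [Function.update_of_ne (by lia)]
        exact h2 l h
      · simp

/-- `arr[a][0] := ∑_{i < n} e`. -/
def sumLoop (i n a : ℕ) (e : RExpr) : Cmd :=
  .seq (.setCell a (.lit 0) (.lit 0))
    (forLoop i n (.setCell a (.lit 0) (.add (.get a (.lit 0)) e)))

theorem runs_sumLoop {i n a : ℕ} {e : RExpr} {σ : State} (v : ℕ → ℝ) (hin : i ≠ n)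
    (he : ∀ k < σ.reg n, ∀ w : ℕ → ℝ,
      e.eval ⟨Function.update σ.reg i k, Function.update σ.arr a w⟩ = v k) :
    Runs G τ (sumLoop i n a e) σ (σ.reg n * (e.cost + 12) + 8)
      (fun σ' => σ'.arr a 0 = ∑ k ∈ Finset.range (σ.reg n), v k) := by
  refine (Runs.setCell_seq (T := σ.reg n * (e.cost + 12) + 5) ?_).le (by simp only [NExpr.cost, RExpr.cost]; lia)
  have h0 : σ.setCell a ((NExpr.lit 0).eval σ) ((RExpr.lit 0).eval σ) = σ.setCell a 0 0 := by
    simp [NExpr.eval, RExpr.eval]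
  rw [h0]
  have hr : (σ.setCell a 0 0).reg = σ.reg := rfl
  have := runs_forLoop (G := G) (τ := τ) (i := i) (n := n) (σ := σ.setCell a 0 0)
    (body := .setCell a (.lit 0) (.add (.get a (.lit 0)) e)) (T := e.cost + 5)
    (fun k σ' => (∃ w, σ' = ⟨Function.update σ.reg i k, Function.update σ.arr a w⟩ ∧
      w 0 = ∑ k ∈ Finset.range k, v k)) hin rfl rfl ?_ ?_
  · refine this.mono (by rw [hr]) ?_
    rintro σ' ⟨w, rfl, h⟩
    rw [hr] at h
    simpa using h
  · exact ⟨Function.update (σ.arr a) 0 0, by simp [State.setReg, State.setCell], by simp⟩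
  · rintro k hk σ' ⟨w, rfl, h⟩ -
    refine (Runs.setCell ?_).le (by simp only [NExpr.cost, RExpr.cost]; lia)
    refine ⟨Function.update w 0 (w 0 + v k), ?_, ?_⟩
    · simp only [RExpr.eval, he k hk w]
      simp [State.setCell, State.setReg, NExpr.eval]
    · simp [h, Finset.sum_range_succ]

end RealRAM

/-! ### Merge sort -/

/-- Each of the blocks `[b w, (b + 1) w)`, cut off at `n`, is sorted. -/
def BlockSorted (w n : ℕ) (A : ℕ → ℝ) : Prop :=
  ∀ b p q, b * w ≤ p → p ≤ q → q < (b + 1) * w → q < n → A p ≤ A q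

/-- Every entry of `A` below `n` is an entry of `B` below `n`. -/
def Covers (n : ℕ) (A B : ℕ → ℝ) : Prop := ∀ l < n, ∃ p < n, B p = A l

/-- This inclusion is the only half of "permutation" that the projection needs: every breakpoint
must occur in the sorted array. -/
theorem Covers.trans {n : ℕ} {A B C : ℕ → ℝ} (h : Covers n A B) (h' : Covers n B C) :
    Covers n A C := by
  intro l hl
  obtain ⟨p, hp, e⟩ := h l hl
  obtain ⟨q, hq, e'⟩ := h' p hp
  exact ⟨q, hq, e'.trans e⟩

/-- The state of a merge pass from `A` to `B` with block width `w`: position `k` of the output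
lies in the double block `[s, e)`, the halves `[s, mid)` and `[mid, e)` of which have been consumed
up to `i` and `j`. -/
structure MergeInv (w n : ℕ) (A B : ℕ → ℝ) (s k i j mid e : ℕ) : Prop where
  dvd : ∃ b, s = b * (2 * w)
  mid_eq : mid = min (s + w) n
  end_eq : e = min (s + 2 * w) n
  le_i : s ≤ i
  i_le : i ≤ mid
  le_j : mid ≤ j
  j_le : j ≤ e
  count : k + mid = i + j
  sorted : BlockSorted (2 * w) k B
  le_left : ∀ p, s ≤ p → p < k → ∀ l, i ≤ l → l < mid → B p ≤ A l
  le_right : ∀ p, s ≤ p → p < k → ∀ l, j ≤ l → l < e → B p ≤ A l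
  cover : ∀ l, l < i ∨ (mid ≤ l ∧ l < j) → ∃ p < k, B p = A l

namespace MergeInv

variable {w n : ℕ} {A B : ℕ → ℝ} {s k i j mid e : ℕ}

theorem init (w n : ℕ) (A B : ℕ → ℝ) :
    MergeInv w n A B 0 0 0 (min w n) (min w n) (min (2 * w) n) where
  dvd := ⟨0, by simp⟩
  mid_eq := by simp
  end_eq := by simp
  le_i := le_rfl
  i_le := by lia
  le_j := le_rfl
  j_le := by lia
  count := by lia
  sorted := fun b p q _ _ _ h => by lia
  le_left := fun p _ h => by lia
  le_right := fun p _ h => by lia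
  cover := fun l h => by lia

theorem next (h : MergeInv w n A B s k i j mid e) (hk : e ≤ k) (hkn : k < n) :
    MergeInv w n A B k k k (min (k + w) n) (min (k + w) n) (min (k + 2 * w) n) := by
  obtain ⟨⟨b, hb⟩, h1, h2, h3, h4, h5, h6, h7, h8, h9, h10, h11⟩ := h
  refine ⟨⟨b + 1, ?_⟩, rfl, rfl, le_rfl, by lia, le_rfl, by lia, by lia, h8,
    fun p _ _ => by lia, fun p _ _ => by lia, ?_⟩
  · have : (b + 1) * (2 * w) = b * (2 * w) + 2 * w := by ring
    lia
  · intro l hl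
    exact h11 l (by lia)

/-- Only the current double block is affected, and there the new entry comes last and dominates all
earlier ones. -/
theorem blockSorted_push (h : MergeInv w n A B s k i j mid e) (hke : k < e) {x : ℝ}
    (hx : ∀ p, s ≤ p → p < k → B p ≤ x) :
    BlockSorted (2 * w) (k + 1) (Function.update B k x) := by
  obtain ⟨⟨b, hb⟩, h1, h2, h3, h4, h5, h6, h7, h8, h9, h10, h11⟩ := h
  intro b' p q hp hpq hq hqk
  rcases Nat.lt_succ_iff_lt_or_eq.mp hqk with h | rfl
  · rw [Function.update_of_ne (by lia), Function.update_of_ne (by lia)]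
    exact h8 b' p q hp hpq hq h
  · rcases hpq.lt_or_eq with h | rfl
    · rw [Function.update_of_ne (by lia), Function.update_self]
      refine hx p ?_ h
      -- The block containing position `k` cannot lie before the current one, because `k ≥ s`; hence
      -- `p ≥ s` and `hx` applies.
      have : b < b' + 1 := by
        refine Nat.lt_of_mul_lt_mul_right (a := 2 * w) ?_
        lia
      have : b * (2 * w) ≤ b' * (2 * w) := Nat.mul_le_mul_right _ (by lia)
      lia
    · simp

theorem push_left (h : MergeInv w n A B s k i j mid e) (hA : BlockSorted w n A)
    (hi : i < mid) (hij : j < e → A i ≤ A j) :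
    MergeInv w n A (Function.update B k (A i)) s (k + 1) (i + 1) j mid e := by
  have hke : k < e := by
    have := h.count; have := h.j_le; lia
  have hs := h.blockSorted_push hke (x := A i) fun p h1 h2 => h.le_left p h1 h2 i le_rfl hi
  obtain ⟨⟨b, hb⟩, h1, h2, h3, h4, h5, h6, h7, h8, h9, h10, h11⟩ := h
  -- The two halves are the blocks `2 b` and `2 b + 1` of width `w`, each sorted by `hA`.
  have hb1 : 2 * b * w = s := by rw [hb]; ring
  have hb2 : (2 * b + 1) * w = s + w := by rw [hb]; ring
  have hb3 : (2 * b + 1 + 1) * w = s + 2 * w := by rw [hb]; ring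
  refine ⟨⟨b, hb⟩, h1, h2, by lia, by lia, h5, h6, by lia, hs, ?_, ?_, ?_⟩
  · intro p hp hpk l hl hlm
    rcases Nat.lt_succ_iff_lt_or_eq.mp hpk with h | rfl
    · rw [Function.update_of_ne (by lia)]
      exact h9 p hp h l (by lia) hlm
    · rw [Function.update_self]
      exact hA (2 * b) i l (by lia) (by lia) (by lia) (by lia)
  · intro p hp hpk l hl hle
    rcases Nat.lt_succ_iff_lt_or_eq.mp hpk with h | rfl
    · rw [Function.update_of_ne (by lia)]
      exact h10 p hp h l (by lia) hle
    · rw [Function.update_self]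
      exact (hij (by lia)).trans (hA (2 * b + 1) j l (by lia) (by lia) (by lia) (by lia))
  · intro l hl
    rcases eq_or_ne l i with rfl | hli
    · exact ⟨k, by lia, by simp⟩
    · obtain ⟨p, hp, hpe⟩ := h11 l (by lia)
      exact ⟨p, by lia, by rw [Function.update_of_ne (by lia), hpe]⟩

theorem push_right (h : MergeInv w n A B s k i j mid e) (hA : BlockSorted w n A)
    (hj : j < e) (hij : i < mid → A j ≤ A i) :
    MergeInv w n A (Function.update B k (A j)) s (k + 1) i (j + 1) mid e := by
  have hke : k < e := by
    have := h.count; have := h.i_le; lia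
  have hs := h.blockSorted_push hke (x := A j) fun p h1 h2 => h.le_right p h1 h2 j le_rfl hj
  obtain ⟨⟨b, hb⟩, h1, h2, h3, h4, h5, h6, h7, h8, h9, h10, h11⟩ := h
  have hb1 : 2 * b * w = s := by rw [hb]; ring
  have hb2 : (2 * b + 1) * w = s + w := by rw [hb]; ring
  have hb3 : (2 * b + 1 + 1) * w = s + 2 * w := by rw [hb]; ring
  refine ⟨⟨b, hb⟩, h1, h2, by lia, by lia, by lia, by lia, by lia, hs, ?_, ?_, ?_⟩
  · intro p hp hpk l hl hlm
    rcases Nat.lt_succ_iff_lt_or_eq.mp hpk with h | rfl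
    · rw [Function.update_of_ne (by lia)]
      exact h9 p hp h l (by lia) hlm
    · rw [Function.update_self]
      exact (hij (by lia)).trans (hA (2 * b) i l (by lia) (by lia) (by lia) (by lia))
  · intro p hp hpk l hl hle
    rcases Nat.lt_succ_iff_lt_or_eq.mp hpk with h | rfl
    · rw [Function.update_of_ne (by lia)]
      exact h10 p hp h l (by lia) hle
    · rw [Function.update_self]
      exact hA (2 * b + 1) j l (by lia) (by lia) (by lia) (by lia)
  · intro l hl
    rcases eq_or_ne l j with rfl | hli
    · exact ⟨k, by lia, by simp⟩
    · obtain ⟨p, hp, hpe⟩ := h11 l (by lia)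
      exact ⟨p, by lia, by rw [Function.update_of_ne (by lia), hpe]⟩

theorem covers (h : MergeInv w n A B s n i j mid e) : Covers n A B := by
  obtain ⟨⟨b, hb⟩, h1, h2, h3, h4, h5, h6, h7, h8, h9, h10, h11⟩ := h
  intro l hl
  exact h11 l (by lia)

end MergeInv

/-! ### Merge sort on the machine -/

namespace RealRAM

variable {m : ℕ} {G : EuclideanSpace ℝ (Fin m) → EuclideanSpace ℝ (Fin m)} {τ : ℕ}

/-- Start a new double block of the merge pass at position `reg 12`. -/
def mergeStart : Cmd :=
  .seq (.setReg 13 (.reg 12)) <|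
  .seq (.setReg 15 (.sub (.add (.reg 12) (.reg 11)) (.sub (.add (.reg 12) (.reg 11)) (.reg 10)))) <|
  .seq (.setReg 14 (.reg 15)) <|
  .setReg 16 (.sub (.add (.reg 12) (.add (.reg 11) (.reg 11)))
    (.sub (.add (.reg 12) (.add (.reg 11) (.reg 11))) (.reg 10)))

theorem runs_mergeStart (σ : State) :
    Runs G τ mergeStart σ 40 (fun σ' => σ' = ⟨Function.update (Function.update (Function.update
      (Function.update σ.reg 13 (σ.reg 12)) 15 (min (σ.reg 12 + σ.reg 11) (σ.reg 10)))
      14 (min (σ.reg 12 + σ.reg 11) (σ.reg 10))) 16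
        (min (σ.reg 12 + 2 * σ.reg 11) (σ.reg 10)), σ.arr⟩) := by
  refine (Runs.setReg_seq <| Runs.setReg_seq <| Runs.setReg_seq <| Runs.setReg ?_).le (by simp [NExpr.cost])
  simp only [State.setReg, NExpr.eval, Function.update_self, State.mk.injEq, and_true]
  -- Integer expressions have no minimum; truncated subtraction supplies it.
  have e1 : ∀ a b : ℕ, a - (a - b) = min a b := fun a b => by lia
  simp [e1, two_mul]

/-- Move the smaller one of the two heads of the block halves to the output. -/
def mergeStep : Cmd :=
  .ite (.and (.natLt (.reg 13) (.reg 15)) (.not (.and (.natLt (.reg 14) (.reg 16))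
      (.not (.realLe (.get 12 (.reg 13)) (.get 12 (.reg 14)))))))
    (.seq (.setCell 13 (.reg 12) (.get 12 (.reg 13)))
      (.setReg 13 (.add (.reg 13) (.lit 1))))
    (.seq (.setCell 13 (.reg 12) (.get 12 (.reg 14)))
      (.setReg 14 (.add (.reg 14) (.lit 1))))

/-- One pass of merge sort: doubles the width of the sorted blocks. -/
def mergePass : Cmd :=
  .seq (.setReg 12 (.lit 0)) <| .seq mergeStart <| .seq
    (forLoop 12 10 (.seq (.ite (.natLt (.reg 12) (.reg 16)) .skip mergeStart) mergeStep))
    (fillLoop 12 10 12 (.get 13 (.reg 12)))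

/-- Sort the first `reg 10` cells of array `12`. -/
def mergeSort : Cmd :=
  .seq (.setReg 11 (.lit 1))
    (.while (.natLt (.reg 11) (.reg 10)) (.seq mergePass (.setReg 11 (.add (.reg 11) (.reg 11)))))

/-- The invariant of a merge pass, in terms of the machine state. -/
def MergeState (w n : ℕ) (A : ℕ → ℝ) (σ : State) (k : ℕ) : Prop :=
  σ.reg 10 = n ∧ σ.reg 11 = w ∧ σ.arr 12 = A ∧
    ∃ s, MergeInv w n A (σ.arr 13) s k (σ.reg 13) (σ.reg 14) (σ.reg 15) (σ.reg 16)

theorem runs_mergeStep {w n k : ℕ} {A : ℕ → ℝ} {σ : State} (hA : BlockSorted w n A)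
    (h : MergeState w n A σ k) (hk : σ.reg 12 = k) (hke : k < σ.reg 16) :
    Runs G τ mergeStep σ 24 (fun σ' => MergeState w n A σ' (k + 1)) := by
  obtain ⟨h1, h2, h3, s, h⟩ := h
  refine (Runs.ite (T := 8) (fun hb => ?_) (fun hb => ?_)).le
    (by simp [BExpr.cost, NExpr.cost, RExpr.cost])
  · simp only [BExpr.Holds, NExpr.eval, RExpr.eval, h3] at hb
    refine (Runs.setCell_seq <| Runs.setReg ?_).le
      (by simp [NExpr.cost, RExpr.cost])
    have := h.push_left hA hb.1 (fun hj => by by_contra hc; exact hb.2 ⟨hj, hc⟩)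
    simpa [MergeState, State.setCell, State.setReg, NExpr.eval, RExpr.eval, h1, h2, h3, hk]
      using ⟨s, this⟩
  · simp only [BExpr.Holds, NExpr.eval, RExpr.eval, h3] at hb
    refine (Runs.setCell_seq <| Runs.setReg ?_).le
      (by simp [NExpr.cost, RExpr.cost])
    -- As `k < e`, the two halves are not both exhausted; with an exhausted right half the test
    -- would have chosen the left one.
    have hj : σ.reg 14 < σ.reg 16 := by
      by_contra hc
      have := h.count; have := h.i_le; have := h.j_le
      exact hb ⟨by lia, fun h' => hc h'.1⟩
    have := h.push_right hA hj (fun hi => by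
      by_contra hc
      exact hb ⟨hi, fun h' => h'.2 (not_le.mp hc).le⟩)
    simpa [MergeState, State.setCell, State.setReg, NExpr.eval, RExpr.eval, h1, h2, h3, hk]
      using ⟨s, this⟩

theorem runs_mergePass {w n : ℕ} {A : ℕ → ℝ} {σ : State} (hA : BlockSorted w n A)
    (hw : 0 < w) (h1 : σ.reg 10 = n) (h2 : σ.reg 11 = w) (h3 : σ.arr 12 = A) :
    Runs G τ mergePass σ (n * 100 + 60) (fun σ' => BlockSorted (2 * w) n (σ'.arr 12) ∧
      Covers n A (σ'.arr 12)) := by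
  have loop : ∀ σ₂, MergeState w n A σ₂ 0 → Runs G τ
      (forLoop 12 10 (.seq (.ite (.natLt (.reg 12) (.reg 16)) .skip mergeStart) mergeStep)) σ₂
      (n * (68 + 7) + 5) (fun σ' => MergeState w n A σ' n) := by
    intro σ₂ hσ
    have e10 := hσ.1
    rw [← e10]
    refine runs_forLoop (fun k σ' => MergeState w (σ₂.reg 10) A σ' k) (by decide) rfl rfl
      ?_ ?_
    · rw [e10]; exact hσ
    · intro k hk σ₃ h₃ h12
      rw [e10] at *
      have : Runs G τ (.ite (.natLt (.reg 12) (.reg 16)) .skip mergeStart) σ₃ 44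
          (fun σ' => MergeState w n A σ' k ∧ σ'.reg 12 = k ∧ k < σ'.reg 16) := by
        refine (Runs.ite (T := 40) (fun hb => ?_) (fun hb => ?_)).le
          (by simp [BExpr.cost, NExpr.cost])
        · simp only [BExpr.Holds, NExpr.eval] at hb
          exact (Runs.skip ⟨h₃, h12, by lia⟩).le (by lia)
        · simp only [BExpr.Holds, NExpr.eval] at hb
          refine (runs_mergeStart σ₃).mono le_rfl ?_
          rintro σ' rfl
          obtain ⟨g1, g2, g3, s, g⟩ := h₃
          have := g.next (by lia) hk
          refine ⟨?_, by simp [h12], by simp [h12, g1, g2]; lia⟩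
          simpa [MergeState, g1, g2, g3, h12] using ⟨k, this⟩
      refine (this.seq (T' := 24) fun σ₄ h₄ => (runs_mergeStep hA h₄.1 h₄.2.1 h₄.2.2).mono
        le_rfl ?_)
      rintro σ' ⟨g1, g2, g3, s, g⟩
      exact ⟨by simpa [State.setReg] using g1, by simpa [State.setReg] using g2, g3, s,
        by simpa [State.setReg] using g⟩
  refine (Runs.setReg_seq (T := n * 100 + 58) ?_).le (by simp only [NExpr.cost]; lia)
  refine ((runs_mergeStart _).seq (T' := n * 100 + 18) fun σ₂ h₂ => ?_).le (by lia)
  refine ((loop σ₂ ?_).seq (T' := n * 12 + 5) fun σ₃ h₃ => ?_).le (by lia)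
  · subst h₂
    simpa [MergeState, State.setReg, h1, h2, h3, NExpr.eval] using
      ⟨0, MergeInv.init w n A _⟩
  · obtain ⟨g1, g2, g3, s, g⟩ := h₃
    have := runs_fillLoop (G := G) (τ := τ) (i := 12) (n := 10) (a := 12) (σ := σ₃)
      (e := .get 13 (.reg 12)) (σ₃.arr 13) (by decide)
      (fun k hk w hw => by simp [RExpr.eval, NExpr.eval])
    rw [g1] at this
    refine this.mono (by simp only [RExpr.cost, NExpr.cost]; lia) fun σ' h' => ⟨?_, ?_⟩
    · intro b p q hp hpq hq hqn
      rw [h' p (by lia), h' q hqn]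
      exact g.sorted b p q hp hpq hq hqn
    · intro l hl
      obtain ⟨p, hp, e⟩ := g.covers l hl
      exact ⟨p, hp, by rw [h' p hp, e]⟩

/-- The block width doubles in each pass, so `clog n - log w` decreases by one and bounds the number
of linear-time passes. -/
theorem runs_mergeSort {n : ℕ} {σ : State} (h1 : σ.reg 10 = n) :
    Runs G τ mergeSort σ (Nat.clog 2 n * (n * 100 + 67) + 5) (fun σ' =>
      (∀ p q, p ≤ q → q < n → σ'.arr 12 p ≤ σ'.arr 12 q) ∧
      Covers n (σ.arr 12) (σ'.arr 12)) := by
  have key := Runs.while_variant (G := G) (τ := τ) (σ := σ.setReg 11 1) (T := n * 100 + 64)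
    (n := Nat.clog 2 n) (b := .natLt (.reg 11) (.reg 10))
    (p := .seq mergePass (.setReg 11 (.add (.reg 11) (.reg 11))))
    (fun σ' => σ'.reg 10 = n ∧ 0 < σ'.reg 11 ∧ BlockSorted (σ'.reg 11) n (σ'.arr 12) ∧
      Covers n (σ.arr 12) (σ'.arr 12))
    (fun σ' => Nat.clog 2 n - Nat.log 2 (σ'.reg 11)) ?_ ?_ (by simp)
  · refine (Runs.setReg_seq (T := Nat.clog 2 n * (n * 100 + 64 + 3) + 3) ?_).le
      (by simp only [NExpr.cost]; lia)
    refine key.mono le_rfl ?_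
    rintro σ' ⟨⟨g1, g2, g3, g4⟩, hb⟩
    simp only [BExpr.Holds, NExpr.eval, g1] at hb
    exact ⟨fun p q hpq hq => g3 0 p q (by lia) hpq (by lia) hq, g4⟩
  · rintro σ₁ ⟨g1, g2, g3, g4⟩ hb
    simp only [BExpr.Holds, NExpr.eval, g1] at hb
    refine ((runs_mergePass g3 g2 g1 rfl rfl).frame.seq (T' := 4) fun σ₂ h₂ =>
      Runs.setReg ?_).le le_rfl
    obtain ⟨⟨k1, k2⟩, hf⟩ := h₂
    have r10 := hf.reg 10 rfl
    have r11 := hf.reg 11 rfl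
    simp only [State.setReg, NExpr.eval, Function.update_self, r11, ne_eq,
      Nat.reduceEqDiff, not_false_eq_true, Function.update_of_ne, r10, g1, ← two_mul]
    refine ⟨⟨trivial, by lia, k1, g4.trans k2⟩, ?_⟩
    have e1 : Nat.log 2 (σ₁.reg 11) < Nat.clog 2 n :=
      (Nat.lt_clog_iff_pow_lt one_lt_two).mpr ((Nat.pow_log_le_self 2 g2.ne').trans_lt hb)
    have e2 : Nat.log 2 (2 * σ₁.reg 11) = Nat.log 2 (σ₁.reg 11) + 1 := by
      rw [mul_comm, Nat.log_mul_base one_lt_two g2.ne']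
    lia
  · refine ⟨by simpa [State.setReg] using h1, by simp [State.setReg], ?_, ?_⟩
    · simp only [State.setReg, Function.update_self]
      intro b p q hp hpq hq _
      have : p = q := by lia
      rw [this]
    · exact fun l hl => ⟨l, hl, rfl⟩

end RealRAM

/-! ### Projection onto the feasible set -/

/-- `w` is the Euclidean projection of `q` onto the convex set `Z`. -/
def IsProj {E : Type*} [NormedAddCommGroup E] [InnerProductSpace ℝ E] (Z : Set E) (q w : E) :
    Prop :=
  w ∈ Z ∧ ∀ x ∈ Z, inner ℝ (q - w) (x - w) ≤ 0

/-- The point of `[0, u]` nearest to `x`. -/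
noncomputable def clip (x u : ℝ) : ℝ := if x ≤ 0 then 0 else if u ≤ x then u else x

theorem clip_nonneg {x u : ℝ} (hu : 0 ≤ u) : 0 ≤ clip x u := by
  unfold clip; split_ifs <;> linarith

theorem clip_le {x u : ℝ} (hu : 0 ≤ u) : clip x u ≤ u := by
  unfold clip; split_ifs <;> linarith

theorem clip_mono {x y u : ℝ} (hu : 0 ≤ u) (h : x ≤ y) : clip x u ≤ clip y u := by
  unfold clip; split_ifs <;> linarith

theorem clip_optimal {x u v : ℝ} (hv : 0 ≤ v) (hvu : v ≤ u) :
    (x - clip x u) * (v - clip x u) ≤ 0 := by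
  unfold clip; split_ifs
  · exact mul_nonpos_of_nonpos_of_nonneg (by linarith) (by linarith)
  · exact mul_nonpos_of_nonneg_of_nonpos (by linarith) (by linarith)
  · simp

/-- As a function of `t`, `clip (q - t) u` has kinks only at `q` and `q - u`. Neither lies strictly
between `a` and `b`, so a single affine piece is valid on the whole interval. -/
theorem clip_affine {q u a b r : ℝ} (hu : 0 ≤ u) (hab : a ≤ b) (hr : 0 ≤ r) (hr' : r ≤ 1)
    (h1 : q ≤ a ∨ b ≤ q) (h2 : q - u ≤ a ∨ b ≤ q - u) :
    clip (q - (a + r * (b - a))) u = clip (q - a) u + r * (clip (q - b) u - clip (q - a) u) := by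
  have e1 : 0 ≤ r * (b - a) := mul_nonneg hr (by linarith)
  have e2 : r * (b - a) ≤ b - a := mul_le_of_le_one_left (by linarith) hr'
  have key : ∀ t, a ≤ t → t ≤ b → clip (q - t) u = if q ≤ a then 0 else if b ≤ q - u then u
      else q - t := by
    intro t ht ht'
    unfold clip
    split_ifs <;> first | rfl | (rcases h1 with h1 | h1 <;> rcases h2 with h2 | h2 <;> linarith)
  rw [key _ (by linarith) (by linarith), key a le_rfl hab, key b hab le_rfl]
  split_ifs <;> ring

/-- The mass of `clip (q - t) u`, as a function of the water level `t`. -/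
noncomputable def waterSum (m : ℕ) (q u : ℕ → ℝ) (t : ℝ) : ℝ :=
  ∑ k ∈ Finset.range m, clip (q k - t) (u k)

theorem waterSum_anti {m : ℕ} {q u : ℕ → ℝ} (hu : ∀ k < m, 0 ≤ u k) {a b : ℝ} (h : a ≤ b) :
    waterSum m q u b ≤ waterSum m q u a :=
  Finset.sum_le_sum fun k hk => clip_mono (hu k (Finset.mem_range.mp hk)) (by linarith)

/-- At a level below all `q k - u k` every coordinate sits at its upper bound, so the mass is
maximal over all levels. This provides the lower end of the binary search. -/
theorem waterSum_le {m : ℕ} {q u : ℕ → ℝ} (hu : ∀ k < m, 0 ≤ u k) {a b : ℝ}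
    (h : ∀ k < m, a ≤ q k - u k) : waterSum m q u b ≤ waterSum m q u a := by
  refine Finset.sum_le_sum fun k hk => ?_
  have hk := Finset.mem_range.mp hk
  have e := hu k hk
  have : clip (q k - a) (u k) = u k := by
    have := h k hk
    unfold clip; split_ifs <;> linarith
  rw [this]
  exact clip_le e

theorem waterSum_eq_zero {m : ℕ} {q u : ℕ → ℝ} {a : ℝ} (h : ∀ k < m, q k ≤ a) :
    waterSum m q u a = 0 := by
  refine Finset.sum_eq_zero fun k hk => ?_
  have := h k (Finset.mem_range.mp hk)
  unfold clip
  rw [if_pos (by linarith)]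

/-- Between adjacent breakpoints, the level of mass one is found by linear interpolation. -/
theorem waterSum_interpolate {m : ℕ} {q u : ℕ → ℝ} (hu : ∀ k < m, 0 ≤ u k) {a b : ℝ}
    (hab : a ≤ b) (h1 : ∀ k < m, q k ≤ a ∨ b ≤ q k) (h2 : ∀ k < m, q k - u k ≤ a ∨ b ≤ q k - u k)
    (ha : 1 < waterSum m q u a) (hb : waterSum m q u b ≤ 1) :
    waterSum m q u (a + (waterSum m q u a - 1) / (waterSum m q u a - waterSum m q u b) * (b - a))
      = 1 := by
  set r := (waterSum m q u a - 1) / (waterSum m q u a - waterSum m q u b) with hr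
  have hpos : 0 < waterSum m q u a - waterSum m q u b := by linarith
  have hr0 : 0 ≤ r := div_nonneg (by linarith) hpos.le
  have hr1 : r ≤ 1 := (div_le_one hpos).mpr (by linarith)
  have : waterSum m q u (a + r * (b - a)) =
      waterSum m q u a + r * (waterSum m q u b - waterSum m q u a) := by
    simp only [waterSum, Finset.mul_sum, ← Finset.sum_sub_distrib, ← Finset.sum_add_distrib]
    refine Finset.sum_congr rfl fun k hk => ?_
    have hk := Finset.mem_range.mp hk
    exact clip_affine (hu k hk) hab hr0 hr1 (h1 k hk) (h2 k hk)
  rw [this, hr]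
  field_simp
  ring

theorem mem_feasibleSet_iff {m : ℕ} {c : ℝ} (hc : 0 < c) {s z : EuclideanSpace ℝ (Fin m)} :
    z ∈ feasibleSet c s ↔ (∀ j, 0 ≤ z j) ∧ ∑ j, z j ≤ 1 ∧ ∀ j, z j ≤ s j / c := by
  constructor
  · rintro ⟨h1, h2, h3⟩
    refine ⟨fun j => (h1 j).1, ?_, fun j => (le_div_iff₀' hc).mpr (h3 j)⟩
    simpa only [abs_of_nonneg (h1 _).1] using h2
  · rintro ⟨h1, h2, h3⟩
    refine ⟨fun j => ⟨h1 j, ?_⟩, ?_, fun j => (le_div_iff₀' hc).mp (h3 j)⟩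
    · exact (Finset.single_le_sum (fun i _ => h1 i) (Finset.mem_univ j)).trans h2
    · simpa only [abs_of_nonneg (h1 _)] using h2

/-- These are the optimality conditions with `t` as multiplier of the mass constraint. Writing `q -
w` as `(q - t - w) + t`, the first part is nonpositive coordinatewise by `clip_optimal`, and the
second by complementary slackness. -/
theorem isProj_of_level {m : ℕ} {c : ℝ} (hc : 0 < c) {s q w : EuclideanSpace ℝ (Fin m)}
    (hs : ∀ j, 0 < s j) {t : ℝ} (ht : 0 ≤ t) (hw : ∀ j, w j = clip (q j - t) (s j / c))
    (hle : ∑ j, w j ≤ 1) (hcs : t = 0 ∨ ∑ j, w j = 1) : IsProj (feasibleSet c s) q w := by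
  have hu : ∀ j, 0 ≤ s j / c := fun j => (div_pos (hs j) hc).le
  refine ⟨(mem_feasibleSet_iff hc).mpr ⟨fun j => ?_, hle, fun j => ?_⟩, fun x hx => ?_⟩
  · rw [hw]; exact clip_nonneg (hu j)
  · rw [hw]; exact clip_le (hu j)
  obtain ⟨h1, h2, h3⟩ := (mem_feasibleSet_iff hc).mp hx
  have e1 : inner ℝ (q - w) (x - w) =
      ∑ j, (q j - t - w j) * (x j - w j) + t * (∑ j, x j - ∑ j, w j) := by
    rw [PiLp.inner_apply, ← Finset.sum_sub_distrib, Finset.mul_sum, ← Finset.sum_add_distrib]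
    refine Finset.sum_congr rfl fun j _ => ?_
    simp
    ring
  have e2 : ∑ j, (q j - t - w j) * (x j - w j) ≤ 0 := by
    refine Finset.sum_nonpos fun j _ => ?_
    rw [hw]
    exact clip_optimal (h1 j) (h3 j)
  have e3 : t * (∑ j, x j - ∑ j, w j) ≤ 0 := by
    rcases hcs with rfl | h
    · simp
    · exact mul_nonpos_of_nonneg_of_nonpos ht (by linarith)
  linarith

/-! ### The projection on the machine -/

namespace RealRAM

variable {m : ℕ} {G : EuclideanSpace ℝ (Fin m) → EuclideanSpace ℝ (Fin m)} {τ : ℕ}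

/-- The upper bound `s_i / c` of the coordinate with index `reg 1`. -/
def upperBound : RExpr := .div (.get 0 (.reg 1)) (.get 3 (.lit 0))

/-- `arr[10] := clip (arr[9] - arr[24][0])`, with the sum of the entries in `arr[25][0]`. -/
def clipAtLevel : Cmd :=
  .seq (forLoop 1 0 (.seq (.setCell 10 (.reg 1) (.sub (.get 9 (.reg 1)) (.get 24 (.lit 0))))
    (.ite (.realLe (.get 10 (.reg 1)) (.lit 0)) (.setCell 10 (.reg 1) (.lit 0))
      (.ite (.realLe upperBound (.get 10 (.reg 1))) (.setCell 10 (.reg 1) upperBound) .skip))))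
    (sumLoop 1 0 25 (.get 10 (.reg 1)))

/-- The breakpoints of the water level go to array `12`. -/
def breakpoints : Cmd :=
  forLoop 1 0 (.seq (.setCell 12 (.reg 1) (.get 9 (.reg 1)))
    (.setCell 12 (.add (.reg 0) (.reg 1)) (.sub (.get 9 (.reg 1)) upperBound)))

/-- `clipAtLevel` at a given level. -/
def clipAt (e : RExpr) : Cmd := .seq (.setCell 24 (.lit 0) e) clipAtLevel

/-- One round of the binary search for the level of mass one. -/
def searchStep : Cmd :=
  .seq (.setReg 19 (.half (.add (.reg 17) (.reg 18)))) <|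
  .seq (clipAt (.get 12 (.reg 19))) <|
  .ite (.realLe (.get 25 (.lit 0)) (.lit 1)) (.setReg 18 (.reg 19)) (.setReg 17 (.reg 19))

/-- Binary search for the pair of adjacent breakpoints around the level of mass one. -/
def searchLevel : Cmd :=
  .while (.natLt (.add (.reg 17) (.lit 1)) (.reg 18)) searchStep

/-- Interpolation between the breakpoints with indices `reg 17` and `reg 18`. -/
def interpolateLevel : Cmd :=
  .seq (clipAt (.get 12 (.reg 18))) <|
  .seq (.setCell 26 (.lit 0) (.get 25 (.lit 0))) <|
  .seq (clipAt (.get 12 (.reg 17))) <|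
  clipAt (.add (.get 12 (.reg 17))
    (.mul (.div (.sub (.get 25 (.lit 0)) (.lit 1))
      (.sub (.get 25 (.lit 0)) (.get 26 (.lit 0))))
      (.sub (.get 12 (.reg 18)) (.get 12 (.reg 17)))))

/-- Project the vector in array `9` onto the feasible set; the result goes to array `10`. -/
def project : Cmd :=
  .seq (clipAt (.lit 0)) <|
  .ite (.realLe (.get 25 (.lit 0)) (.lit 1)) .skip <|
  .seq breakpoints <| .seq (.setReg 10 (.add (.reg 0) (.reg 0))) <| .seq mergeSort <|
  .seq (.setReg 17 (.lit 0)) <| .seq (.setReg 18 (.sub (.reg 10) (.lit 1))) <|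
  .seq searchLevel interpolateLevel

/-- The data of a projection: dimension, point, and upper bounds. -/
structure ProjData (m : ℕ) (q u : ℕ → ℝ) (σ : State) : Prop where
  dim : σ.reg 0 = m
  point : σ.arr 9 = q
  bound : (fun k => σ.arr 0 k / σ.arr 3 0) = u

theorem ProjData.of_frame {q u : ℕ → ℝ} {p : Cmd} {σ σ' : State} (h : ProjData m q u σ)
    (hf : Frame p σ σ') (h0 : p.writesReg 0 = false) (h9 : p.writesArr 9 = false)
    (h0' : p.writesArr 0 = false) (h3 : p.writesArr 3 = false) : ProjData m q u σ' := by
  obtain ⟨a, b, c⟩ := h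
  exact ⟨by rw [hf.reg 0 h0, a], by rw [hf.arr 9 h9, b],
    by rw [hf.arr 0 h0', hf.arr 3 h3, c]⟩

theorem runs_clipAtLevel {q u : ℕ → ℝ} {σ : State} (h : ProjData m q u σ) :
    Runs G τ clipAtLevel σ (m * 50 + 13) (fun σ' =>
      ((∀ k < m, σ'.arr 10 k = clip (q k - σ.arr 24 0) (u k)) ∧
        σ'.arr 25 0 = waterSum m q u (σ.arr 24 0)) ∧ Frame clipAtLevel σ σ') := by
  refine Runs.frame ?_
  obtain ⟨h0, h9, hu⟩ := h
  have hu' : ∀ k, σ.arr 0 k / σ.arr 3 0 = u k := fun k => congrFun hu k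
  have loop := runs_forLoop (G := G) (τ := τ) (i := 1) (n := 0) (σ := σ) (T := 26)
    (body := .seq (.setCell 10 (.reg 1) (.sub (.get 9 (.reg 1)) (.get 24 (.lit 0))))
    (.ite (.realLe (.get 10 (.reg 1)) (.lit 0)) (.setCell 10 (.reg 1) (.lit 0))
      (.ite (.realLe upperBound (.get 10 (.reg 1))) (.setCell 10 (.reg 1) upperBound) .skip)))
    (fun k σ' => ∃ w, σ' = ⟨Function.update σ.reg 1 k, Function.update σ.arr 10 w⟩ ∧
      ∀ l < k, w l = clip (q l - σ.arr 24 0) (u l)) (by decide) rfl rfl ?_ ?_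
  · refine (loop.seq (T' := m * 14 + 8) fun σ₁ h₁ => ?_).le (by rw [h0]; lia)
    obtain ⟨w, rfl, hw⟩ := h₁
    have := runs_sumLoop (G := G) (τ := τ) (i := 1) (n := 0) (a := 25)
      (e := .get 10 (.reg 1))
      (σ := ⟨Function.update σ.reg 1 (σ.reg 0), Function.update σ.arr 10 w⟩) w (by decide)
      (fun k hk w' => by simp [RExpr.eval, NExpr.eval])
    rw [show (⟨Function.update σ.reg 1 (σ.reg 0), Function.update σ.arr 10 w⟩ : State).reg 0 = m
      by simp [h0]] at this
    refine (this.frame).mono (by simp [RExpr.cost, NExpr.cost]) ?_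
    rintro σ' ⟨hs, hf⟩
    rw [h0] at hw
    refine ⟨fun k hk => ?_, ?_⟩
    · rw [hf.arr 10 rfl]
      simpa using hw k hk
    · rw [hs]
      exact Finset.sum_congr rfl fun k hk => hw k (Finset.mem_range.mp hk)
  · exact ⟨σ.arr 10, by simp [State.setReg], by simp⟩
  · rintro k hk σ' ⟨w, rfl, hw⟩ -
    have push : ∀ x, x = clip (q k - σ.arr 24 0) (u k) →
        ∀ l ≤ k, Function.update w k x l = clip (q l - σ.arr 24 0) (u l) := by
      rintro x rfl l hl
      rcases hl.lt_or_eq with h | rfl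
      · rw [Function.update_of_ne (by lia)]
        exact hw l h
      · simp
    refine (Runs.setCell_seq (T := 19) ?_).le (by simp [NExpr.cost, RExpr.cost])
    refine (Runs.ite (T := 15) (fun hb => ?_) (fun hb => ?_)).le
      (by simp [BExpr.cost, NExpr.cost, RExpr.cost])
    · refine (Runs.setCell ?_).le (by simp [NExpr.cost, RExpr.cost])
      simp [State.setCell, State.setReg, NExpr.eval, RExpr.eval, BExpr.Holds, h9] at hb ⊢
      refine ⟨Function.update w k 0, by simp, push _ ?_⟩
      unfold clip
      rw [if_pos (by linarith)]
    · refine (Runs.ite (T := 7) (fun hb' => ?_) (fun hb' => ?_)).le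
        (by simp [BExpr.cost, NExpr.cost, RExpr.cost, upperBound])
      · refine (Runs.setCell ?_).le (by simp [NExpr.cost, RExpr.cost, upperBound])
        simp [State.setCell, State.setReg, NExpr.eval, RExpr.eval, BExpr.Holds, h9, upperBound,
          hu'] at hb hb' ⊢
        refine ⟨Function.update w k (u k), by simp, push _ ?_⟩
        unfold clip
        rw [if_neg (by linarith), if_pos hb']
      · refine (Runs.skip ?_).le (by lia)
        simp [State.setCell, State.setReg, NExpr.eval, RExpr.eval, BExpr.Holds, h9, upperBound,
          hu'] at hb hb' ⊢
        refine ⟨Function.update w k (q k - σ.arr 24 0), by simp, push _ ?_⟩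
        unfold clip
        rw [if_neg (by linarith), if_neg (by linarith)]

theorem runs_clipAt {q u : ℕ → ℝ} {σ : State} (h : ProjData m q u σ) (e : RExpr) :
    Runs G τ (clipAt e) σ (m * 50 + e.cost + 15) (fun σ' =>
      ((∀ k < m, σ'.arr 10 k = clip (q k - e.eval σ) (u k)) ∧
        σ'.arr 25 0 = waterSum m q u (e.eval σ)) ∧ Frame (clipAt e) σ σ') := by
  refine Runs.frame ?_
  refine (Runs.setCell_seq (T := m * 50 + 13) ?_).le (by simp only [NExpr.cost]; lia)
  have h' : ProjData m q u (σ.setCell 24 (NExpr.eval σ (.lit 0)) (e.eval σ)) := by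
    obtain ⟨a, b, c⟩ := h
    exact ⟨a, by simpa [State.setCell] using b, by simpa [State.setCell] using c⟩
  refine (runs_clipAtLevel h').mono le_rfl ?_
  rintro σ' ⟨h'', -⟩
  simpa [State.setCell, NExpr.eval] using h''

theorem runs_breakpoints {q u : ℕ → ℝ} {σ : State} (h : ProjData m q u σ) :
    Runs G τ breakpoints σ (m * 23 + 5) (fun σ' => ∀ k < m,
      σ'.arr 12 k = q k ∧ σ'.arr 12 (m + k) = q k - u k) := by
  obtain ⟨h0, h9, hu⟩ := h
  have hu' : ∀ k, σ.arr 0 k / σ.arr 3 0 = u k := fun k => congrFun hu k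
  have loop := runs_forLoop (G := G) (τ := τ) (i := 1) (n := 0) (σ := σ) (T := 16)
    (body := .seq (.setCell 12 (.reg 1) (.get 9 (.reg 1)))
    (.setCell 12 (.add (.reg 0) (.reg 1)) (.sub (.get 9 (.reg 1)) upperBound)))
    (fun k σ' => ∃ w, σ' = ⟨Function.update σ.reg 1 k, Function.update σ.arr 12 w⟩ ∧
      ∀ l < k, w l = q l ∧ w (m + l) = q l - u l) (by decide) rfl rfl ?_ ?_
  · refine loop.mono (by rw [h0]) ?_
    rintro σ' ⟨w, rfl, hw⟩
    rw [h0] at hw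
    simpa using hw
  · exact ⟨σ.arr 12, by simp [State.setReg], by simp⟩
  · rintro k hk σ' ⟨w, rfl, hw⟩ -
    refine (Runs.setCell_seq <| Runs.setCell ?_).le
      (by simp [NExpr.cost, RExpr.cost, upperBound])
    refine ⟨Function.update (Function.update w k (q k)) (m + k) (q k - u k), ?_, fun l hl => ?_⟩
    · simp [State.setCell, State.setReg, NExpr.eval, RExpr.eval, upperBound, h9, h0, hu']
    · rw [h0] at hk
      rcases Nat.lt_succ_iff_lt_or_eq.mp hl with h | rfl
      · rw [Function.update_of_ne (by lia), Function.update_of_ne (by lia),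
          Function.update_of_ne (by lia), Function.update_of_ne (by lia)]
        exact hw l h
      · rw [Function.update_of_ne (by lia)]
        simp

/-- `reg 17` and `reg 18` are indices of breakpoints on both sides of the level of mass one. -/
structure Bracket (m : ℕ) (q u B : ℕ → ℝ) (σ : State) : Prop where
  data : ProjData m q u σ
  sorted : σ.arr 12 = B
  lt : σ.reg 17 < σ.reg 18
  lt_two_mul : σ.reg 18 < 2 * m
  lower : 1 < waterSum m q u (B (σ.reg 17))
  upper : waterSum m q u (B (σ.reg 18)) ≤ 1

theorem runs_searchStep {q u B : ℕ → ℝ} {σ : State} (h : Bracket m q u B σ)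
    (hb : σ.reg 17 + 1 < σ.reg 18) :
    Runs G τ searchStep σ (m * 50 + 35) (fun σ' => Bracket m q u B σ' ∧
      Nat.clog 2 (σ'.reg 18 - σ'.reg 17) < Nat.clog 2 (σ.reg 18 - σ.reg 17)) := by
  obtain ⟨h1, h2, h3, h4, h5, h6⟩ := h
  -- Either new bracket has at most half the old width, rounded up, and `Nat.clog` drops by one
  -- under exactly this halving.
  have hlog := Nat.clog_of_one_lt one_lt_two (n := σ.reg 18 - σ.reg 17) (by lia)
  have hlog' : ∀ a ≤ (σ.reg 18 - σ.reg 17 + 2 - 1) / 2,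
      Nat.clog 2 a < Nat.clog 2 (σ.reg 18 - σ.reg 17) := fun a ha => by
    have := Nat.clog_mono_right 2 ha
    lia
  refine (Runs.setReg_seq (T := m * 50 + 29) ?_).le (by simp only [NExpr.cost]; lia)
  have hd : ProjData m q u
      (σ.setReg 19 (NExpr.eval σ (.half (.add (.reg 17) (.reg 18))))) :=
    ⟨by simpa [State.setReg] using h1.dim, h1.point, h1.bound⟩
  refine ((runs_clipAt hd _).seq (T' := 7) fun σ₂ h₂ => ?_).le (by
    simp only [NExpr.cost, RExpr.cost]; lia)
  obtain ⟨⟨-, hw⟩, hf⟩ := h₂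
  have hd₂ := hd.of_frame hf rfl rfl rfl rfl
  have e17 := hf.reg 17 rfl
  have e18 := hf.reg 18 rfl
  have e19 := hf.reg 19 rfl
  have e12 := hf.arr 12 rfl
  simp [State.setReg, NExpr.eval, RExpr.eval, h2] at e17 e18 e19 e12 hw
  refine (Runs.ite (T := 2) (fun hb' => Runs.setReg ?_) (fun hb' => Runs.setReg ?_)).le
    (by simp [BExpr.cost, NExpr.cost, RExpr.cost])
  · simp only [BExpr.Holds, RExpr.eval, NExpr.eval, Rat.cast_one, hw] at hb'
    refine ⟨⟨⟨by simpa [State.setReg] using hd₂.dim, hd₂.point, hd₂.bound⟩, e12,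
      ?_, ?_, ?_, ?_⟩, hlog' _ ?_⟩ <;>
    simp [State.setReg, NExpr.eval, e17, e19]
    · lia
    · lia
    · exact h5
    · exact hb'
    · lia
  · simp only [BExpr.Holds, RExpr.eval, NExpr.eval, Rat.cast_one, hw] at hb'
    refine ⟨⟨⟨by simpa [State.setReg] using hd₂.dim, hd₂.point, hd₂.bound⟩, e12,
      ?_, ?_, ?_, ?_⟩, hlog' _ ?_⟩ <;>
    simp [State.setReg, NExpr.eval, e18, e19]
    · lia
    · lia
    · exact not_le.mp hb'
    · exact h6
    · lia

theorem runs_searchLevel {q u B : ℕ → ℝ} {σ : State} (h : Bracket m q u B σ) :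
    Runs G τ searchLevel σ (Nat.clog 2 (2 * m) * (m * 50 + 40) + 5)
      (fun σ' => Bracket m q u B σ' ∧ σ'.reg 18 = σ'.reg 17 + 1) := by
  have key := Runs.while_variant (G := G) (τ := τ) (σ := σ) (T := m * 50 + 35)
    (n := Nat.clog 2 (2 * m)) (b := .natLt (.add (.reg 17) (.lit 1)) (.reg 18))
    (p := searchStep)
    (fun σ' => Bracket m q u B σ') (fun σ' => Nat.clog 2 (σ'.reg 18 - σ'.reg 17))
    (fun σ₁ h₁ hb => runs_searchStep h₁ hb) h
    (Nat.clog_mono_right _ (by have := h.lt_two_mul; lia))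
  refine key.mono (by simp only [BExpr.cost, NExpr.cost]; lia) fun σ' h' => ⟨h'.1, ?_⟩
  have h1 := h'.2
  have h2 := h'.1.lt
  simp only [BExpr.Holds, NExpr.eval] at h1
  lia

theorem runs_interpolateLevel {q u B : ℕ → ℝ} {σ : State} (h : Bracket m q u B σ)
    (hadj : σ.reg 18 = σ.reg 17 + 1) (hu : ∀ k < m, 0 ≤ u k)
    (hB : ∀ p p', p ≤ p' → p' < 2 * m → B p ≤ B p')
    (hq : ∀ k < m, ∃ p < 2 * m, B p = q k) (hqu : ∀ k < m, ∃ p < 2 * m, B p = q k - u k)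
    (h0 : 1 < waterSum m q u 0) :
    Runs G τ interpolateLevel σ (m * 150 + 100) (fun σ' => ∃ t, 0 ≤ t ∧ waterSum m q u t = 1 ∧
      ∀ k < m, σ'.arr 10 k = clip (q k - t) (u k)) := by
  obtain ⟨h1, h2, h3, h4, h5, h6⟩ := h
  -- The indices are adjacent in the sorted list, so no breakpoint lies strictly between the two
  -- levels, as interpolation requires.
  have adj : ∀ x, (∃ p < 2 * m, B p = x) → x ≤ B (σ.reg 17) ∨ B (σ.reg 18) ≤ x := by
    rintro x ⟨p, hp, rfl⟩
    rcases le_or_gt p (σ.reg 17) with hp' | hp'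
    · exact .inl (hB _ _ hp' (by lia))
    · exact .inr (hB _ _ (by lia) hp)
  have hint := waterSum_interpolate hu (hB _ _ h3.le h4) (fun k hk => adj _ (hq k hk))
    (fun k hk => adj _ (hqu k hk)) h5 h6
  set t := B (σ.reg 17) + (waterSum m q u (B (σ.reg 17)) - 1) / (waterSum m q u (B (σ.reg 17)) -
    waterSum m q u (B (σ.reg 18))) * (B (σ.reg 18) - B (σ.reg 17)) with ht
  -- At a negative level the mass would be at least that at level 0, hence above 1.
  have ht0 : 0 ≤ t := by
    by_contra hc
    have := waterSum_anti (q := q) hu (not_le.mp hc).le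
    linarith
  refine ((runs_clipAt h1 _).seq (T' := m * 100 + 80) fun σ₁ ⟨⟨_, w₁⟩, f₁⟩ => ?_).le (by
    simp only [NExpr.cost, RExpr.cost]; lia)
  have d₁ := h1.of_frame f₁ rfl rfl rfl rfl
  have a₁ := f₁.arr 12 rfl
  have b₁ := f₁.reg 17 rfl
  have c₁ := f₁.reg 18 rfl
  refine (Runs.setCell_seq (T := m * 100 + 70) ?_).le (by
    simp only [NExpr.cost, RExpr.cost]; lia)
  have d₂ : ProjData m q u (σ₁.setCell 26 (NExpr.eval σ₁ (.lit 0))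
      (RExpr.eval σ₁ (.get 25 (.lit 0)))) := ⟨d₁.dim, d₁.point, d₁.bound⟩
  refine ((runs_clipAt d₂ _).seq (T' := m * 50 + 50) fun σ₃ ⟨⟨_, w₃⟩, f₃⟩ => ?_).le (by
    simp only [NExpr.cost, RExpr.cost]; lia)
  have d₃ := d₂.of_frame f₃ rfl rfl rfl rfl
  have a₃ := f₃.arr 12 rfl
  have b₃ := f₃.reg 17 rfl
  have c₃ := f₃.reg 18 rfl
  have g₃ := f₃.arr 26 rfl
  refine (runs_clipAt d₃ _).mono (by simp only [NExpr.cost, RExpr.cost]; lia) fun σ' h' => ?_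
  refine ⟨t, ht0, hint, ?_⟩
  simp [State.setCell, NExpr.eval, RExpr.eval, h2] at a₁ b₁ c₁ w₁ w₃ a₃ b₃ c₃ g₃
  rw [a₁] at w₃ a₃
  rw [b₁] at w₃ b₃
  rw [c₁] at c₃
  have := h'.1.1
  simp only [RExpr.eval, NExpr.eval, a₃, b₃, c₃, w₃, g₃, w₁, Function.update_self,
    Rat.cast_one] at this
  exact this

/-- If level 0 already has mass at most 1, it is the answer. Otherwise the mass exceeds 1 at the
smallest breakpoint and vanishes at the largest, so these bracket the level of mass one. -/
theorem runs_project {q u : ℕ → ℝ} {σ : State} (hm : 0 < m) (h : ProjData m q u σ)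
    (hu : ∀ k < m, 0 ≤ u k) :
    Runs G τ project σ (1000 * (m * (Nat.clog 2 (2 * m) + 1))) (fun σ' => ∃ t, 0 ≤ t ∧
      waterSum m q u t ≤ 1 ∧ (t = 0 ∨ waterSum m q u t = 1) ∧
      ∀ k < m, σ'.arr 10 k = clip (q k - t) (u k)) := by
  set ℓ := Nat.clog 2 (2 * m) with hℓ
  have hmul : ℓ ≤ m * ℓ := Nat.le_mul_of_pos_left _ hm
  refine ((runs_clipAt h _).seq (T' := 400 * (m * ℓ) + 200 * m + 300)
    fun σ₁ ⟨⟨c₁, w₁⟩, f₁⟩ => ?_).le (by simp only [RExpr.cost]; lia)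
  have d₁ := h.of_frame f₁ rfl rfl rfl rfl
  simp only [RExpr.eval, Rat.cast_zero] at c₁ w₁
  refine (Runs.ite (T := 400 * (m * ℓ) + 200 * m + 294) (fun hb => ?_) (fun hb => ?_)).le (by
    simp only [BExpr.cost, RExpr.cost, NExpr.cost]; lia)
  · simp only [BExpr.Holds, RExpr.eval, NExpr.eval, Rat.cast_one, w₁] at hb
    exact (Runs.skip ⟨0, le_rfl, hb, .inl rfl, c₁⟩).le (by lia)
  simp only [BExpr.Holds, RExpr.eval, NExpr.eval, Rat.cast_one, w₁, not_le] at hb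
  refine ((runs_breakpoints d₁).frame.seq (T' := 400 * (m * ℓ) + 160 * m + 289)
    fun σ₂ ⟨w₂, f₂⟩ => ?_).le (by lia)
  have d₂ := d₁.of_frame f₂ rfl rfl rfl rfl
  refine (Runs.setReg_seq (T := 400 * (m * ℓ) + 160 * m + 285) ?_).le
    (by simp only [NExpr.cost]; lia)
  have d₃ : ProjData m q u (σ₂.setReg 10 (NExpr.eval σ₂ (.add (.reg 0) (.reg 0)))) :=
    ⟨by simpa [State.setReg] using d₂.dim, d₂.point, d₂.bound⟩
  have hn : (σ₂.setReg 10 (NExpr.eval σ₂ (.add (.reg 0) (.reg 0)))).reg 10 = 2 * m := by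
    simp [State.setReg, NExpr.eval, d₂.dim, two_mul]
  refine ((runs_mergeSort hn).frame.seq (T' := 50 * (m * ℓ) + 40 * ℓ + 150 * m + 200)
    fun σ₄ ⟨⟨w₄, v₄⟩, f₄⟩ => ?_).le ?_
  swap
  · rw [← hℓ]
    have : ℓ * (2 * m * 100 + 67) = 200 * (m * ℓ) + 67 * ℓ := by ring
    lia
  have d₄ := d₃.of_frame f₄ rfl rfl rfl rfl
  have n₄ := f₄.reg 10 rfl
  rw [hn] at n₄
  refine (Runs.setReg_seq (T := 50 * (m * ℓ) + 40 * ℓ + 150 * m + 190) ?_).le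
    (by simp only [NExpr.cost]; lia)
  refine (Runs.setReg_seq (T := 50 * (m * ℓ) + 40 * ℓ + 150 * m + 180) ?_).le
    (by simp only [NExpr.cost]; lia)
  have hq : ∀ k < m, ∃ p < 2 * m, σ₄.arr 12 p = q k := fun k hk => by
    obtain ⟨p, hp, e⟩ := v₄ k (by lia)
    exact ⟨p, hp, e.trans (w₂ k hk).1⟩
  have hqu : ∀ k < m, ∃ p < 2 * m, σ₄.arr 12 p = q k - u k := fun k hk => by
    obtain ⟨p, hp, e⟩ := v₄ (m + k) (by lia)
    exact ⟨p, hp, e.trans (w₂ k hk).2⟩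
  refine ((runs_searchLevel (q := q) (u := u) (B := σ₄.arr 12) ?_).seq (T' := m * 150 + 100)
    fun σ₅ ⟨h₅, e₅⟩ => ?_).le ?_
  · refine ⟨⟨by simpa [State.setReg] using d₄.dim, d₄.point, d₄.bound⟩, rfl, ?_, ?_, ?_, ?_⟩ <;>
    simp [State.setReg, NExpr.eval, n₄]
    · lia
    · lia
    · refine hb.trans_le (waterSum_le hu fun k hk => ?_)
      obtain ⟨p, hp, e⟩ := hqu k hk
      rw [← e]
      exact w₄ 0 p (by lia) hp
    · rw [waterSum_eq_zero fun k hk => ?_]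
      · exact zero_le_one
      · obtain ⟨p, hp, e⟩ := hq k hk
        rw [← e]
        exact w₄ p (2 * m - 1) (by lia) (by lia)
  · rw [← hℓ]
    have : ℓ * (m * 50 + 40) = 50 * (m * ℓ) + 40 * ℓ := by ring
    lia
  · refine (runs_interpolateLevel h₅ e₅ hu w₄ hq hqu hb).mono le_rfl ?_
    rintro σ' ⟨t, ht, h1, h2⟩
    exact ⟨t, ht, h1.le, .inr h1, h2⟩

theorem isProj_project {c : ℝ} {s : EuclideanSpace ℝ (Fin m)} {σ : State} (hm : 0 < m)
    (hc : 0 < c) (hs : ∀ j, 0 < s j) (h0 : σ.reg 0 = m) (hσs : ∀ j : Fin m, σ.arr 0 j = s j)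
    (hσc : σ.arr 3 0 = c) :
    Runs G τ project σ (1000 * (m * (Nat.clog 2 (2 * m) + 1)))
      (fun σ' => IsProj (feasibleSet c s) (σ.vec m 9) (σ'.vec m 10)) := by
  have hu : ∀ j : Fin m, σ.arr 0 j / σ.arr 3 0 = s j / c := fun j => by rw [hσs, hσc]
  refine (runs_project hm ⟨h0, rfl, rfl⟩ fun k hk => ?_).mono le_rfl ?_
  · rw [hu ⟨k, hk⟩]
    exact (div_pos (hs _) hc).le
  · rintro σ' ⟨t, ht, h1, h2, h3⟩
    have hw : ∀ j, σ'.vec m 10 j = clip (σ.vec m 9 j - t) (s j / c) := fun j => by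
      rw [← hu j]
      exact h3 j j.2
    have hsum : ∑ j, σ'.vec m 10 j = waterSum m (σ.arr 9) (fun k => σ.arr 0 k / σ.arr 3 0) t := by
      rw [waterSum, ← Fin.sum_univ_eq_sum_range
        (fun k => clip (σ.arr 9 k - t) (σ.arr 0 k / σ.arr 3 0))]
      exact Finset.sum_congr rfl fun j _ => h3 j j.2
    exact isProj_of_level hc hs ht hw (by rw [hsum]; exact h1) (by rw [hsum]; exact h2)

end RealRAM

/-! ### First-order methods for smooth convex functions on a convex set -/

section FirstOrder

variable {E : Type*} [NormedAddCommGroup E] [InnerProductSpace ℝ E] {Z : Set E} {f : E → ℝ}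
  {g : E → E} {M : ℝ}

/-- `g` is an `M`-Lipschitz gradient of the convex function `f` on `Z`. -/
structure SmoothConvexOn (Z : Set E) (f : E → ℝ) (g : E → E) (M : ℝ) : Prop where
  convex : ∀ x ∈ Z, ∀ y ∈ Z, f x + inner ℝ (g x) (y - x) ≤ f y
  lipschitz : ∀ x ∈ Z, ∀ y ∈ Z, ‖g x - g y‖ ≤ M * ‖x - y‖

/-- `x` solves the variational inequality of `h` on `Z`. -/
def IsVISolution (Z : Set E) (h : E → E) (x : E) : Prop :=
  x ∈ Z ∧ ∀ y ∈ Z, 0 ≤ inner ℝ (h x) (y - x)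

namespace SmoothConvexOn

theorem mono {M' : ℝ} (hf : SmoothConvexOn Z f g M) (h : M ≤ M') : SmoothConvexOn Z f g M' :=
  ⟨hf.convex, fun x hx y hy => (hf.lipschitz x hx y hy).trans (by gcongr)⟩

/-- Convexity at `y` and Cauchy–Schwarz suffice, without integrating along the segment. The price is
the factor `M` instead of `M / 2`, which doubles the constants of the accelerated method. -/
theorem upper (hf : SmoothConvexOn Z f g M) {x y : E} (hx : x ∈ Z) (hy : y ∈ Z) :
    f y ≤ f x + inner ℝ (g x) (y - x) + M * ‖y - x‖ ^ 2 := by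
  have h1 := hf.convex y hy x hx
  have h2 : inner ℝ (g y - g x) (y - x) ≤ M * ‖y - x‖ ^ 2 := by
    refine (real_inner_le_norm _ _).trans ?_
    rw [pow_two, ← mul_assoc]
    gcongr
    exact hf.lipschitz y hy x hx
  rw [inner_sub_left] at h2
  rw [← neg_sub y x, inner_neg_right] at h1
  linarith

theorem monotone (hf : SmoothConvexOn Z f g M) {x y : E} (hx : x ∈ Z) (hy : y ∈ Z) :
    0 ≤ inner ℝ (g x - g y) (x - y) := by
  have h1 := hf.convex x hx y hy
  have h2 := hf.convex y hy x hx
  rw [← neg_sub x y, inner_neg_right] at h1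
  rw [inner_sub_left]
  linarith

/-- At each point `f` is squeezed between an affine and a quadratic function with the same value
there. -/
theorem continuousOn (hf : SmoothConvexOn Z f g M) : ContinuousOn f Z := by
  intro x hx
  have h1 : Filter.Tendsto (fun y => f x + inner ℝ (g x) (y - x)) (nhdsWithin x Z)
      (nhds (f x)) := by
    have : Continuous fun y => f x + inner ℝ (g x) (y - x) := by fun_prop
    simpa using (this.tendsto x).mono_left nhdsWithin_le_nhds
  have h2 : Filter.Tendsto (fun y => f x + inner ℝ (g x) (y - x) + M * ‖y - x‖ ^ 2)
      (nhdsWithin x Z) (nhds (f x)) := by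
    have : Continuous fun y => f x + inner ℝ (g x) (y - x) + M * ‖y - x‖ ^ 2 := by fun_prop
    simpa using (this.tendsto x).mono_left nhdsWithin_le_nhds
  exact tendsto_of_tendsto_of_tendsto_of_le_of_le' h1 h2
    (Filter.eventually_of_mem self_mem_nhdsWithin fun y hy => hf.convex x hx y hy)
    (Filter.eventually_of_mem self_mem_nhdsWithin fun y hy => hf.upper hx hy)

/-- A minimizer exists by compactness. Comparing it with `x + t (y - x)` by `upper`, dividing by `t`
and letting `t` tend to 0 gives the inequality. -/
theorem exists_isVISolution (hf : SmoothConvexOn Z f g M) (hZ : IsCompact Z) (hc : Convex ℝ Z)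
    (hne : Z.Nonempty) : ∃ x, IsVISolution Z g x := by
  obtain ⟨x, hx, hmin⟩ := hZ.exists_isMinOn hne hf.continuousOn
  refine ⟨x, hx, fun y hy => ?_⟩
  set a := inner ℝ (g x) (y - x) with ha
  set b := M * ‖y - x‖ ^ 2 with hb
  have key : ∀ t : ℝ, 0 < t → t ≤ 1 → 0 ≤ a + t * b := fun t ht ht' => by
    have hz : x + t • (y - x) ∈ Z := hc.add_smul_sub_mem hx hy ⟨ht.le, ht'⟩
    have h1 := hf.upper hx hz
    have h2 : f x ≤ f (x + t • (y - x)) := hmin hz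
    rw [add_sub_cancel_left, inner_smul_right, norm_smul, Real.norm_of_nonneg ht.le] at h1
    have : 0 ≤ t * (a + t * b) := by
      rw [ha, hb]
      linarith [h1, h2, mul_pow t ‖y - x‖ 2, show t * (a + t * b) = t * a + M * (t * ‖y - x‖) ^ 2
        by rw [hb]; ring]
    exact nonneg_of_mul_nonneg_right this ht
  have hlim : Filter.Tendsto (fun t : ℝ => a + t * b) (nhdsWithin 0 (Set.Ioi 0)) (nhds a) := by
    have : Continuous fun t : ℝ => a + t * b := by fun_prop
    simpa using (this.tendsto 0).mono_left nhdsWithin_le_nhds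
  refine ge_of_tendsto hlim ?_
  filter_upwards [Ioc_mem_nhdsGT (zero_lt_one (α := ℝ))] with t ht
  exact key t ht.1 ht.2

/-- Adding a quadratic function with Hessian `S` and linear term `-p`. -/
theorem add_quadratic (hf : SmoothConvexOn Z f g M) {S : ℝ} (hS : 0 ≤ S) (p : E) :
    SmoothConvexOn Z (fun x => f x + (S / 2 * ‖x‖ ^ 2 - inner ℝ p x))
      (fun x => g x + (S • x - p)) (M + S) := by
  constructor
  · intro x hx y hy
    have h1 := hf.convex x hx y hy
    have h2 : S / 2 * ‖y‖ ^ 2 = S / 2 * ‖x‖ ^ 2 + S * inner ℝ x (y - x) + S / 2 * ‖y - x‖ ^ 2 := by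
      have : ‖y‖ ^ 2 = ‖x‖ ^ 2 + 2 * inner ℝ x (y - x) + ‖y - x‖ ^ 2 := by
        rw [← norm_add_sq_real, add_sub_cancel]
      rw [this]; ring
    have h3 : 0 ≤ S / 2 * ‖y - x‖ ^ 2 := by positivity
    have h4 : inner ℝ p y = inner ℝ p x + inner ℝ p (y - x) := by
      rw [← inner_add_right, add_sub_cancel]
    rw [inner_add_left, inner_sub_left, inner_smul_left]
    simp only [conj_trivial]
    linarith
  · intro x hx y hy
    have e : g x + (S • x - p) - (g y + (S • y - p)) = (g x - g y) + S • (x - y) := by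
      rw [smul_sub]; abel
    rw [e, add_mul]
    refine (norm_add_le _ _).trans (add_le_add (hf.lipschitz x hx y hy) ?_)
    rw [norm_smul, Real.norm_of_nonneg hS]

/-- The quadratic part expands exactly around `x`; the variational inequality makes the first-order
terms nonnegative, leaving the square. -/
theorem quadratic_growth (hf : SmoothConvexOn Z f g M) {S : ℝ} {p x : E}
    (hx : IsVISolution Z (fun x => g x + (S • x - p)) x) {y : E} (hy : y ∈ Z) :
    S / 2 * ‖y - x‖ ^ 2 ≤ f y + (S / 2 * ‖y‖ ^ 2 - inner ℝ p y) -
      (f x + (S / 2 * ‖x‖ ^ 2 - inner ℝ p x)) := by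
  have h1 := hf.convex x hx.1 y hy
  have h2 : S / 2 * ‖y‖ ^ 2 = S / 2 * ‖x‖ ^ 2 + S * inner ℝ x (y - x) + S / 2 * ‖y - x‖ ^ 2 := by
    have : ‖y‖ ^ 2 = ‖x‖ ^ 2 + 2 * inner ℝ x (y - x) + ‖y - x‖ ^ 2 := by
      rw [← norm_add_sq_real, add_sub_cancel]
    rw [this]; ring
  have h4 : inner ℝ p y = inner ℝ p x + inner ℝ p (y - x) := by
    rw [← inner_add_right, add_sub_cancel]
  have h5 := hx.2 y hy
  rw [inner_add_left, inner_sub_left, inner_smul_left] at h5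
  simp only [conj_trivial] at h5
  linarith

/-- One step of the accelerated projected gradient method. -/
theorem accelerated_step (hf : SmoothConvexOn Z f g M) (hc : Convex ℝ Z) (hM : 0 < M) {t : ℝ}
    (ht : 1 ≤ t) {x u y u' x' : E} (hx : x ∈ Z) (hu : u ∈ Z)
    (hy : y = x + (2 / (t + 1)) • (u - x))
    (hu' : IsProj Z (u - (t / (4 * M)) • g y) u') (hx' : x' = x + (2 / (t + 1)) • (u' - x))
    {w : E} (hw : w ∈ Z) :
    t * (t + 1) / 4 * (f x' - f w) + M * ‖u' - w‖ ^ 2 ≤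
      (t - 1) * t / 4 * (f x - f w) + M * ‖u - w‖ ^ 2 := by
  have hr : 2 / (t + 1) ∈ Set.Icc (0 : ℝ) 1 :=
    ⟨by positivity, (div_le_one (by linarith)).mpr (by linarith)⟩
  have hyZ : y ∈ Z := by rw [hy]; exact hc.add_smul_sub_mem hx hu hr
  have hxZ : x' ∈ Z := by rw [hx']; exact hc.add_smul_sub_mem hx hu'.1 hr
  have h1 := hf.upper hyZ hxZ
  have h2 := hf.convex y hyZ x hx
  have h3 := hf.convex y hyZ w hw
  have h4 := hu'.2 w hw
  have t1 : t + 1 ≠ 0 := by linarith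
  have e1 : x' - y = (2 / (t + 1)) • (u' - u) := by
    rw [hx', hy, ← sub_eq_zero]
    module
  have n1 : ‖x' - y‖ ^ 2 = (2 / (t + 1)) ^ 2 * ‖u' - u‖ ^ 2 := by
    rw [e1, norm_smul, mul_pow, Real.norm_of_nonneg hr.1]
  -- The weights are chosen so that the linear terms at `x` and `w` match the convexity inequalities
  -- `h2` and `h3`; what remains is a term in `u' - w`.
  have e2 : inner ℝ (g y) (x' - y) * (t * (t + 1) / 4) =
      (t - 1) * t / 4 * inner ℝ (g y) (x - y) + t / 2 * inner ℝ (g y) (w - y) +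
        t / 2 * inner ℝ (g y) (u' - w) := by
    have : (t * (t + 1) / 4) • (x' - y) = ((t - 1) * t / 4) • (x - y) + (t / 2) • (w - y) +
        (t / 2) • (u' - w) := by
      have ex : x' = x + (2 / (t + 1)) • (u' - x) := hx'
      rw [ex, ← sub_eq_zero]
      have : (t * (t + 1) / 4) • (2 / (t + 1)) • (u' - x) = (t / 2) • (u' - x) := by
        rw [smul_smul]; congr 1; field_simp; ring
      rw [smul_sub, smul_add, this]
      module
    have := congrArg (inner ℝ (g y)) this
    simp only [inner_add_right, inner_smul_right] at this
    linarith
  -- The three-point inequality of the projection. Its term `-M ‖u' - u‖²` absorbs the curvature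
  -- term bounded in `e4`, where the factor is `t / (t + 1)`.
  have e3 : t / 2 * inner ℝ (g y) (u' - w) ≤
      M * (‖u - w‖ ^ 2 - ‖u' - w‖ ^ 2 - ‖u' - u‖ ^ 2) := by
    have k1 : inner ℝ (u - (t / (4 * M)) • g y - u') (w - u') =
        inner ℝ (u - u') (w - u') + t / (4 * M) * inner ℝ (g y) (u' - w) := by
      rw [show u - (t / (4 * M)) • g y - u' = (u - u') - (t / (4 * M)) • g y by abel,
        inner_sub_left, inner_smul_left, ← neg_sub u' w, inner_neg_right, inner_neg_right]
      simp
    have k2 : 2 * inner ℝ (u - u') (w - u') = ‖u' - u‖ ^ 2 + ‖u' - w‖ ^ 2 - ‖u - w‖ ^ 2 := by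
      have := norm_sub_sq_real (u - u') (w - u')
      rw [sub_sub_sub_cancel_right] at this
      rw [norm_sub_rev u' u, norm_sub_rev u' w]
      linarith
    rw [k1] at h4
    have k3 : t / 2 * inner ℝ (g y) (u' - w) =
        2 * M * (t / (4 * M) * inner ℝ (g y) (u' - w)) := by
      field_simp; ring
    rw [k3]
    nlinarith
  have e4 : t * (t + 1) / 4 * (M * ((2 / (t + 1)) ^ 2 * ‖u' - u‖ ^ 2)) ≤ M * ‖u' - u‖ ^ 2 := by
    have : t * (t + 1) / 4 * (M * ((2 / (t + 1)) ^ 2 * ‖u' - u‖ ^ 2)) =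
        t / (t + 1) * (M * ‖u' - u‖ ^ 2) := by
      field_simp; ring
    rw [this]
    exact mul_le_of_le_one_left (by positivity) ((div_le_one (by linarith)).mpr (by linarith))
  rw [n1] at h1
  have c1 : 0 ≤ t * (t + 1) / 4 := by positivity
  have c2 : 0 ≤ (t - 1) * t / 4 := by
    have : 0 ≤ t - 1 := by linarith
    positivity
  have c3 : 0 ≤ t / 2 := by positivity
  have m1 := mul_le_mul_of_nonneg_left h1 c1
  have m2 := mul_le_mul_of_nonneg_left h2 c2
  have m3 := mul_le_mul_of_nonneg_left h3 c3
  have e5 : t * (t + 1) / 4 = (t - 1) * t / 4 + t / 2 := by ring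
  rw [e5] at m1 e2 e4 ⊢
  linarith

end SmoothConvexOn

/-! ### Regularized solutions and recursive regularization -/

/-- The distance to the solution does not increase when the problem is regularized at the current
point. -/
theorem IsVISolution.norm_sub_le_of_regularize {h : E → E} {σ : ℝ} (hσ : 0 < σ) {x y y' : E}
    (hmono : ∀ x ∈ Z, ∀ y ∈ Z, 0 ≤ inner ℝ (h x - h y) (x - y))
    (hy : IsVISolution Z h y) (hy' : IsVISolution Z (fun z => h z + σ • (z - x)) y') :
    ‖x - y'‖ ≤ ‖x - y‖ := by
  have h1 := hy.2 y' hy'.1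
  have h2 := hy'.2 y hy.1
  have h3 := hmono y' hy'.1 y hy.1
  rw [inner_add_left, inner_smul_left, conj_trivial] at h2
  rw [inner_sub_left] at h3
  have e1 : inner ℝ (h y') (y - y') = - inner ℝ (h y') (y' - y) := by
    rw [← neg_sub y' y, inner_neg_right]
  -- Adding both variational inequalities and monotonicity leaves `σ` times this inner product: the
  -- angle at `y'` in the triangle `x, y', y` is at least a right angle.
  have h4 : 0 ≤ inner ℝ (y' - x) (y - y') := by
    refine (mul_nonneg_iff_of_pos_left hσ).mp ?_
    linarith
  have h5 := norm_add_sq_real (y' - x) (y - y')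
  rw [sub_add_sub_cancel'] at h5
  rw [norm_sub_rev x y', norm_sub_rev x y]
  refine le_of_sq_le_sq ?_ (norm_nonneg _)
  nlinarith [sq_nonneg ‖y - y'‖]

theorem IsProj.norm_sub_le {q q' w w' : E} (h : IsProj Z q w) (h' : IsProj Z q' w') :
    ‖w - w'‖ ≤ ‖q - q'‖ := by
  have h1 := h.2 w' h'.1
  have h2 := h'.2 w h.1
  have h3 : ‖w - w'‖ ^ 2 ≤ inner ℝ (q - q') (w - w') := by
    have : inner ℝ (q - q') (w - w') - ‖w - w'‖ ^ 2 =
        - inner ℝ (q - w) (w' - w) - inner ℝ (q' - w') (w - w') := by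
      rw [← real_inner_self_eq_norm_sq, ← inner_sub_left, ← neg_sub w w', inner_neg_right,
        neg_neg, ← inner_sub_left]
      congr 1
      abel
    linarith
  have h4 := h3.trans (real_inner_le_norm _ _)
  rcases (norm_nonneg (w - w')).eq_or_lt with h | h
  · rw [← h]; positivity
  · nlinarith

theorem IsVISolution.isProj {h : E → E} {x : E} (hx : IsVISolution Z h x) {a : ℝ} (ha : 0 ≤ a) :
    IsProj Z (x - a • h x) x := by
  refine ⟨hx.1, fun y hy => ?_⟩
  rw [sub_sub_cancel_left, inner_neg_left, inner_smul_left, conj_trivial]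
  have := mul_nonneg ha (hx.2 y hy)
  linarith

/-- The state at the start of stage `k` of recursive regularization: the current point is `x`, and
the regularizer is the quadratic function with Hessian `S` and linear term `-p`. -/
structure StageInv (Z : Set E) (g : E → E) (σ₀ D : ℝ) (k : ℕ) (x : E) (S : ℝ) (p : E) : Prop where
  nonneg : 0 ≤ S
  le : S ≤ 4 ^ k * σ₀ / 3
  drift : ‖S • x - p‖ ≤ 3 / 2 * σ₀ * D * (1 - 1 / 16 ^ k)
  exists_near : ∃ y, IsVISolution Z (fun z => g z + (S • z - p)) y ∧ ‖x - y‖ ≤ D / 64 ^ k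

theorem StageInv.zero (hf : SmoothConvexOn Z f g M) (hZ : IsCompact Z) (hc : Convex ℝ Z)
    {σ₀ D : ℝ} (hσ₀ : 0 ≤ σ₀) {x : E} (hx : x ∈ Z)
    (hD : ∀ x ∈ Z, ∀ y ∈ Z, ‖x - y‖ ≤ D) : StageInv Z g σ₀ D 0 x 0 0 := by
  obtain ⟨y, hy⟩ := hf.exists_isVISolution hZ hc ⟨x, hx⟩
  exact ⟨le_rfl, by positivity, by simp, y, by simpa using hy, by simpa using hD x hx y hy.1⟩

/-- Regularizing at `x` does not move the solution farther from `x`, so `‖x - y'‖` keeps the old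
bound. Accelerated steps with quadratic growth then bring `x'` 64 times closer to `y'`. -/
theorem StageInv.succ (hf : SmoothConvexOn Z f g M) (hZ : IsCompact Z) (hc : Convex ℝ Z)
    {σ₀ D : ℝ} (hσ₀ : 0 < σ₀) (hD : 0 ≤ D) (hM : 0 < M) {k : ℕ} {x : E} {S : ℝ} {p : E}
    (h : StageInv Z g σ₀ D k x S p) {N : ℝ} (hN : 0 ≤ N) (hNσ : 65536 * M ≤ N ^ 2 * (4 ^ k * σ₀))
    {x' : E} (hx' : x' ∈ Z)
    (hacc : ∀ w ∈ Z, N * (N + 1) / 4 *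
      (f x' + ((S + 4 ^ k * σ₀) / 2 * ‖x'‖ ^ 2 - inner ℝ (p + (4 ^ k * σ₀) • x) x') -
        (f w + ((S + 4 ^ k * σ₀) / 2 * ‖w‖ ^ 2 - inner ℝ (p + (4 ^ k * σ₀) • x) w))) ≤
      2 * M * ‖x - w‖ ^ 2) :
    StageInv Z g σ₀ D (k + 1) x' (S + 4 ^ k * σ₀) (p + (4 ^ k * σ₀) • x) := by
  obtain ⟨h1, h2, h3, y, hy, hxy⟩ := h
  set σ := 4 ^ k * σ₀ with hσdef
  have hσ : 0 < σ := by positivity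
  obtain ⟨y', hy'⟩ := (hf.add_quadratic (S := S + σ) (by linarith)
    (p + σ • x)).exists_isVISolution hZ hc ⟨x', hx'⟩
  have hy'' : IsVISolution Z (fun z => g z + (S • z - p) + σ • (z - x)) y' := by
    convert hy' using 2
    module
  have hxy' : ‖x - y'‖ ≤ D / 64 ^ k :=
    (hy.norm_sub_le_of_regularize hσ
      (fun a ha b hb => (hf.add_quadratic h1 p).monotone ha hb) hy'').trans hxy
  have hclose : ‖x' - y'‖ ≤ ‖x - y'‖ / 64 := by
    have g1 := hf.quadratic_growth hy' hx'
    have g2 := hacc y' hy'.1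
    have c : 0 ≤ N * (N + 1) / 4 := by positivity
    have g3 := mul_le_mul_of_nonneg_left g1 c
    -- With `65536 M ≤ N² σ` this yields `8192 M ‖x' - y'‖² ≤ 2 M ‖x - y'‖²`, and `4096 = 64²`.
    have g4 : N ^ 2 * σ / 8 * ‖x' - y'‖ ^ 2 ≤
        N * (N + 1) / 4 * ((S + σ) / 2 * ‖x' - y'‖ ^ 2) := by
      have : N ^ 2 * σ / 8 ≤ N * (N + 1) / 4 * ((S + σ) / 2) := by
        have e1 : 0 ≤ N * σ := by positivity
        have e2 : 0 ≤ N * (N + 1) * S := by positivity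
        nlinarith
      rw [← mul_assoc (N * (N + 1) / 4)]
      exact mul_le_mul_of_nonneg_right this (sq_nonneg _)
    have g5 : 65536 * M / 8 * ‖x' - y'‖ ^ 2 ≤ N ^ 2 * σ / 8 * ‖x' - y'‖ ^ 2 :=
      mul_le_mul_of_nonneg_right (by linarith) (sq_nonneg _)
    have g6 : M * (4096 * ‖x' - y'‖ ^ 2) ≤ M * ‖x - y'‖ ^ 2 := by linarith
    have g7 := le_of_mul_le_mul_left g6 hM
    refine le_of_sq_le_sq ?_ (by positivity)
    rw [div_pow]
    linarith
  have hstep : ‖x' - x‖ ≤ 65 / 64 * (D / 64 ^ k) := by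
    have := norm_sub_le_norm_sub_add_norm_sub x' y' x
    rw [norm_sub_rev y' x] at this
    linarith
  refine ⟨by linarith, ?_, ?_, y', hy', ?_⟩
  · rw [pow_succ, mul_comm (4 ^ k) 4, mul_assoc, ← hσdef]
    linarith
  · have e : (S + σ) • x' - (p + σ • x) = (S • x - p) + (S + σ) • (x' - x) := by module
    rw [e]
    refine (norm_add_le _ _).trans ?_
    rw [norm_smul, Real.norm_of_nonneg (by linarith)]
    -- The increment of the drift is at most `65/48 · σ₀ D / 16 ^ k`. The invariant allows `3/2 ·
    -- 15/16 = 45/32` times the same quantity, which is larger.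
    have b1 : (S + σ) * ‖x' - x‖ ≤ 4 / 3 * σ * (65 / 64 * (D / 64 ^ k)) := by
      gcongr
      linarith
    have b2 : σ * (D / 64 ^ k) = σ₀ * D * (1 / 16 ^ k) := by
      rw [hσdef, show (64 : ℝ) ^ k = 4 ^ k * 16 ^ k by rw [← mul_pow]; norm_num]
      field_simp
    have b3 : (1 : ℝ) / 16 ^ (k + 1) = 1 / 16 ^ k / 16 := by
      rw [pow_succ, ← div_div]
    have b4 : 0 ≤ σ₀ * D * (1 / 16 ^ k) := by positivity
    rw [b3]
    nlinarith
  · rw [pow_succ, ← div_div]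
    linarith

/-- After the last stage, the gradient mapping is small. -/
theorem StageInv.norm_residual_le (hf : SmoothConvexOn Z f g M) (hM : 0 < M) {ξ D : ℝ}
    (hξ : 0 < ξ) (hD : 0 ≤ D) {j : ℕ} {x : E} {S : ℝ} {p : E}
    (hj : M = 4 ^ j * ξ) (hx : x ∈ Z) (h : StageInv Z g (ξ / 16) D (j + 1) x S p) {x' : E}
    (hx' : IsProj Z (x - (1 / M) • g x) x') :
    ‖g x' - g x + M • (x - x')‖ ≤ 5 / 16 * ξ * D := by
  obtain ⟨h1, h2, h3, y, hy, hxy⟩ := h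
  have hSM : S ≤ M := by
    rw [hj]
    rw [pow_succ] at h2
    have : 0 < 4 ^ j * ξ := by positivity
    linarith
  have hlip := (hf.add_quadratic h1 p).lipschitz x hx y hy.1
  -- The solution `y` is a fixed point of the regularized gradient step, so nonexpansiveness
  -- compares `x'` with `y`.
  have hn := hx'.norm_sub_le (hy.isProj (a := 1 / M) (by positivity))
  have e1 : x - (1 / M) • g x - (y - (1 / M) • (g y + (S • y - p))) = (x - y) +
      (1 / M) • ((S • x - p) - (g x + (S • x - p) - (g y + (S • y - p)))) := by module
  rw [e1] at hn
  have b1 : ‖x' - y‖ ≤ ‖x - y‖ + 1 / M * (‖S • x - p‖ + 2 * M * ‖x - y‖) := by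
    refine hn.trans ((norm_add_le _ _).trans ?_)
    rw [norm_smul, Real.norm_of_nonneg (by positivity : 0 ≤ 1 / M)]
    gcongr
    refine (norm_sub_le _ _).trans ?_
    gcongr
    refine hlip.trans ?_
    gcongr
    linarith
  have b2 : M * ‖x' - x‖ ≤ 4 * (M * ‖x - y‖) + ‖S • x - p‖ := by
    have := norm_sub_le_norm_sub_add_norm_sub x' y x
    rw [norm_sub_rev y x] at this
    have : M * ‖x' - x‖ ≤ M * (2 * ‖x - y‖ + 1 / M * (‖S • x - p‖ + 2 * M * ‖x - y‖)) := by
      gcongr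
      linarith
    refine this.trans (le_of_eq ?_)
    field_simp
    ring
  have b3 : M * ‖x - y‖ ≤ ξ * D / 64 := by
    calc M * ‖x - y‖ ≤ M * (D / 64 ^ (j + 1)) := by gcongr
      _ = ξ * D / 64 * (1 / 16 ^ j) := by
        rw [hj, pow_succ, show (64 : ℝ) ^ j = 4 ^ j * 16 ^ j by rw [← mul_pow]; norm_num]
        field_simp
      _ ≤ ξ * D / 64 * 1 := by
        gcongr
        exact (div_le_one (by positivity)).mpr (one_le_pow₀ (by norm_num))
      _ = _ := mul_one _
  have b4 : ‖S • x - p‖ ≤ 3 / 32 * ξ * D := by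
    refine h3.trans ?_
    have : 0 ≤ ξ * D * (1 / 16 ^ (j + 1)) := by positivity
    linarith
  have b5 : ‖g x' - g x + M • (x - x')‖ ≤ 2 * (M * ‖x' - x‖) := by
    refine (norm_add_le _ _).trans ?_
    have := hf.lipschitz x' hx'.1 x hx
    rw [norm_smul, Real.norm_of_nonneg hM.le, norm_sub_rev x x']
    linarith
  linarith

/-- A small gradient mapping certifies an approximate first-order minimizer. -/
theorem IsProj.inner_le_norm_residual (hM : 0 < M) {x x' : E}
    (hx' : IsProj Z (x - (1 / M) • g x) x') {y : E} (hy : y ∈ Z) :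
    inner ℝ (y - x') (-g x') ≤ ‖y - x'‖ * ‖g x' - g x + M • (x - x')‖ := by
  have h1 := mul_le_mul_of_nonneg_left (hx'.2 y hy) hM.le
  -- Up to the residual, `-g x'` is a multiple of the projection's normal vector at `x'`.
  have e : -g x' = M • (x - (1 / M) • g x - x') - (g x' - g x + M • (x - x')) := by
    have : M • (1 / M) • g x = g x := by
      rw [smul_smul, mul_one_div_cancel hM.ne', one_smul]
    rw [smul_sub, smul_sub, this]
    module
  rw [e, inner_sub_right, inner_smul_right, real_inner_comm]
  have h2 := real_inner_le_norm (y - x') (-(g x' - g x + M • (x - x')))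
  rw [inner_neg_right, norm_neg] at h2
  linarith

end FirstOrder

/-! ### The objective function of the `x`-update -/

/-- The first-order condition for a concave function that is differentiable relative to `Z`. -/
theorem ConcaveOn.le_add_inner_gradientWithin {E : Type*} [NormedAddCommGroup E]
    [InnerProductSpace ℝ E] [CompleteSpace E] {Z : Set E} {θ : E → ℝ} (h : ConcaveOn ℝ Z θ)
    (hd : DifferentiableOn ℝ θ Z) {x y : E} (hx : x ∈ Z) (hy : y ∈ Z) :
    θ y ≤ θ x + inner ℝ (gradientWithin θ Z x) (y - x) := by
  set φ : ℝ → ℝ := fun t => θ (x + t • (y - x)) with hφ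
  have hmem : ∀ t ∈ Set.Icc (0 : ℝ) 1, x + t • (y - x) ∈ Z := fun t ht =>
    h.1.add_smul_sub_mem hx hy ht
  have hder : HasDerivWithinAt φ (inner ℝ (gradientWithin θ Z x) (y - x)) (Set.Icc 0 1) 0 := by
    have h1 := (hd x hx).hasGradientWithinAt.hasFDerivWithinAt
    have h2 : HasDerivWithinAt (fun t : ℝ => x + t • (y - x)) (y - x) (Set.Icc 0 1) 0 := by
      simpa using ((hasDerivWithinAt_id (0 : ℝ) (Set.Icc 0 1)).smul_const (y - x)).const_add x
    have h3 : HasFDerivWithinAt θ (InnerProductSpace.toDual ℝ E (gradientWithin θ Z x)) Z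
        (x + (0 : ℝ) • (y - x)) := by simpa using h1
    exact h3.comp_hasDerivWithinAt (0 : ℝ) h2 hmem
  rw [hasDerivWithinAt_iff_tendsto_slope] at hder
  -- By concavity every difference quotient from 0 along the segment is at least the full increment;
  -- the limit is the derivative.
  have hle : ∀ᶠ t in nhdsWithin (0 : ℝ) (Set.Icc 0 1 \ {0}), θ y - θ x ≤ slope φ 0 t := by
    refine Filter.eventually_of_mem self_mem_nhdsWithin fun t ht => ?_
    have ht0 : 0 < t := lt_of_le_of_ne ht.1.1 (Ne.symm ht.2)
    have hc := h.2 hx hy (sub_nonneg.mpr ht.1.2) ht0.le (sub_add_cancel 1 t)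
    have e : (1 - t) • x + t • y = x + t • (y - x) := by module
    rw [e] at hc
    simp only [slope_def_field, hφ, zero_smul, add_zero, sub_zero, smul_eq_mul] at hc ⊢
    rw [le_div_iff₀ ht0]
    linarith
  have hne : (nhdsWithin (0 : ℝ) (Set.Icc 0 1 \ {0})).NeBot := by
    rw [Set.Icc_sdiff_left]
    exact left_nhdsWithin_Ioc_neBot zero_lt_one
  have := ge_of_tendsto hder hle
  linarith

section FeasibleSet

variable {m : ℕ} {c : ℝ} {s : EuclideanSpace ℝ (Fin m)}

theorem zero_mem_feasibleSet (hs : ∀ j, 0 < s j) : (0 : EuclideanSpace ℝ (Fin m)) ∈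
    feasibleSet c s := by
  refine ⟨fun j => ?_, ?_, fun j => ?_⟩
  · simp
  · simp
  · simpa using (hs j).le

theorem convex_feasibleSet (hc : 0 < c) : Convex ℝ (feasibleSet c s) := by
  intro x hx y hy a b ha hb hab
  rw [mem_feasibleSet_iff hc] at *
  obtain ⟨x1, x2, x3⟩ := hx
  obtain ⟨y1, y2, y3⟩ := hy
  refine ⟨fun j => ?_, ?_, fun j => ?_⟩
  · have := mul_nonneg ha (x1 j)
    have := mul_nonneg hb (y1 j)
    simp
    linarith
  · simp only [PiLp.add_apply, PiLp.smul_apply, smul_eq_mul, Finset.sum_add_distrib,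
      ← Finset.mul_sum]
    nlinarith
  · have h1 := mul_le_mul_of_nonneg_left (x3 j) ha
    have h2 := mul_le_mul_of_nonneg_left (y3 j) hb
    have h3 : a * (s j / c) + b * (s j / c) = s j / c := by rw [← add_mul, hab, one_mul]
    simp
    linarith

/-- On `[0, 1]` one has `(a - b)² ≤ a + b`, and the coordinates of each point sum to at most 1. The
bound is free of the dimension. -/
theorem norm_sub_le_sqrt_two (hc : 0 < c) {x y : EuclideanSpace ℝ (Fin m)}
    (hx : x ∈ feasibleSet c s) (hy : y ∈ feasibleSet c s) : ‖x - y‖ ≤ √2 := by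
  refine Real.le_sqrt_of_sq_le ?_
  rw [EuclideanSpace.real_norm_sq_eq]
  have hx' := (mem_feasibleSet_iff hc).mp hx
  have hy' := (mem_feasibleSet_iff hc).mp hy
  calc ∑ j, (x - y) j ^ 2 ≤ ∑ j, (x j + y j) := by
        refine Finset.sum_le_sum fun j _ => ?_
        have h1 := hx.1 j
        have h2 := hy.1 j
        simp only [PiLp.sub_apply]
        nlinarith [mul_nonneg h1.1 h2.1]
    _ ≤ 2 := by
        rw [Finset.sum_add_distrib]
        linarith [hx'.2.1, hy'.2.1]

theorem isCompact_feasibleSet (hc : 0 < c) : IsCompact (feasibleSet c s) := by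
  refine Metric.isCompact_of_isClosed_isBounded ?_ ?_
  · have : feasibleSet c s = (⋂ j, {z : EuclideanSpace ℝ (Fin m) | 0 ≤ z j}) ∩
        ({z : EuclideanSpace ℝ (Fin m) | ∑ j, z j ≤ 1} ∩
          ⋂ j, {z : EuclideanSpace ℝ (Fin m) | z j ≤ s j / c}) := by
      ext z
      simp [mem_feasibleSet_iff hc]
    rw [this]
    exact (isClosed_iInter fun j => isClosed_le (by fun_prop) (by fun_prop)).inter
      ((isClosed_le (by fun_prop) (by fun_prop)).inter
        (isClosed_iInter fun j => isClosed_le (by fun_prop) (by fun_prop)))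
  · rw [Metric.isBounded_iff]
    exact ⟨√2, fun x hx y hy => by
      rw [dist_eq_norm]; exact norm_sub_le_sqrt_two hc hx hy⟩

/-- The gradient of the negative of the augmented Lagrangian, in terms of the oracle. -/
def objectiveGrad (G : EuclideanSpace ℝ (Fin m) → EuclideanSpace ℝ (Fin m)) (ρ : ℝ)
    (z γ x : EuclideanSpace ℝ (Fin m)) : EuclideanSpace ℝ (Fin m) :=
  γ - G x + ρ • (x - z)

/-- Expanding `ρ / 2 ‖x - z‖² + γᵀ(x - z)` and dropping constants gives the quadratic form required
by `add_quadratic`. -/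
theorem smoothConvexOn_objective (hc : 0 < c) {β υ ρ L : ℝ}
    {U : EuclideanSpace ℝ (Fin m) → ℝ} (z γ : EuclideanSpace ℝ (Fin m))
    {G : EuclideanSpace ℝ (Fin m) → EuclideanSpace ℝ (Fin m)} (hυ : 0 < υ) (hρ : 0 < ρ)
    (hU : IsUtility (feasibleSet c s) β U)
    (hL : ∀ x ∈ feasibleSet c s, ∀ y ∈ feasibleSet c s,
      ‖gradientWithin (smoothedLog U υ) (feasibleSet c s) x -
        gradientWithin (smoothedLog U υ) (feasibleSet c s) y‖ ≤ L * ‖x - y‖)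
    (hG : ∀ x ∈ feasibleSet c s, G x = gradientWithin (smoothedLog U υ) (feasibleSet c s) x) :
    SmoothConvexOn (feasibleSet c s)
      (fun x => -smoothedLog U υ x + (ρ / 2 * ‖x‖ ^ 2 - inner ℝ (ρ • z - γ) x))
      (objectiveGrad G ρ z γ) (L + ρ) := by
  have hpos : ∀ x ∈ feasibleSet c s, 0 < U x + υ := fun x hx => by
    have := (hU.mem_Icc x hx).1
    linarith
  have hd : DifferentiableOn ℝ (smoothedLog U υ) (feasibleSet c s) :=
    (hU.differentiableOn.add_const υ).log fun x hx => (hpos x hx).ne'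
  have hconc : ConcaveOn ℝ (feasibleSet c s) (smoothedLog U υ) := by
    refine ⟨convex_feasibleSet hc, fun x hx y hy a b ha hb hab => ?_⟩
    have h1 := strictConcaveOn_log_Ioi.concaveOn.2 (hpos x hx) (hpos y hy) ha hb hab
    refine h1.trans (Real.log_le_log ?_ ?_)
    · exact (convex_Ioi (0 : ℝ)) (hpos x hx) (hpos y hy) ha hb hab
    · have h2 := hU.concaveOn.2 hx hy ha hb hab
      simp only [smul_eq_mul] at h2 ⊢
      have : a * υ + b * υ = υ := by rw [← add_mul, hab, one_mul]
      linarith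
  have h0 : SmoothConvexOn (feasibleSet c s) (fun x => -smoothedLog U υ x) (fun x => -G x) L := by
    refine ⟨fun x hx y hy => ?_, fun x hx y hy => ?_⟩
    · have := hconc.le_add_inner_gradientWithin hd hx hy
      rw [hG x hx, inner_neg_left]
      linarith
    · rw [hG x hx, hG y hy, neg_sub_neg, norm_sub_rev]
      exact hL x hx y hy
  have h1 := h0.add_quadratic hρ.le (ρ • z - γ)
  have e : (fun x => -G x + (ρ • x - (ρ • z - γ))) = objectiveGrad G ρ z γ := by
    funext x
    unfold objectiveGrad
    module
  rwa [e] at h1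

end FeasibleSet

namespace RealRAM

variable {m : ℕ} {G : EuclideanSpace ℝ (Fin m) → EuclideanSpace ℝ (Fin m)} {τ : ℕ}

/-! ### Vector operations of the machine -/

/-- The first `m` cells of array `a` hold the vector `v`. -/
abbrev State.Stores (σ : State) (a : ℕ) (v : EuclideanSpace ℝ (Fin m)) : Prop :=
  ∀ j : Fin m, σ.arr a j = v j

theorem State.Stores.vec_eq {σ : State} {a : ℕ} {v : EuclideanSpace ℝ (Fin m)}
    (h : σ.Stores a v) : σ.vec m a = v := by
  ext j
  exact h j

theorem Frame.stores {p : Cmd} {σ σ' : State} (hf : Frame p σ σ') {a : ℕ}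
    {v : EuclideanSpace ℝ (Fin m)} (h : σ.Stores a v) (ha : p.writesArr a = false) :
    σ'.Stores a v := by
  intro j
  rw [hf.arr a ha]
  exact h j

theorem Frame.cell {p : Cmd} {σ σ' : State} (hf : Frame p σ σ') {a i : ℕ} {v : ℝ}
    (h : σ.arr a i = v) (ha : p.writesArr a = false) : σ'.arr a i = v := by
  rw [hf.arr a ha, h]

theorem Frame.register {p : Cmd} {σ σ' : State} (hf : Frame p σ σ') {r v : ℕ}
    (h : σ.reg r = v) (hr : p.writesReg r = false) : σ'.reg r = v := by
  rw [hf.reg r hr, h]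

theorem runs_fillVec {σ : State} (hm : σ.reg 0 = m) (a : ℕ) (e : RExpr)
    (v : EuclideanSpace ℝ (Fin m))
    (he : ∀ j : Fin m, ∀ w : ℕ → ℝ, w j = σ.arr a j →
      e.eval ⟨Function.update σ.reg 1 j, Function.update σ.arr a w⟩ = v j) :
    Runs G τ (fillLoop 1 0 a e) σ (m * (e.cost + 9) + 5)
      (fun σ' => σ'.Stores a v ∧ Frame (fillLoop 1 0 a e) σ σ') := by
  refine Runs.frame ?_
  have := runs_fillLoop (G := G) (τ := τ) (i := 1) (n := 0) (a := a) (e := e) (σ := σ)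
    (fun k => if h : k < m then v ⟨k, h⟩ else 0) (by decide) (fun k hk w hw => by
      rw [hm] at hk
      simpa [hk] using he ⟨k, hk⟩ w hw)
  rw [hm] at this
  refine this.mono le_rfl fun σ' h j => ?_
  simpa using h j j.2

theorem runs_sumVec {σ : State} (hm : σ.reg 0 = m) (a : ℕ) (e : RExpr) (v : Fin m → ℝ)
    (he : ∀ j : Fin m, ∀ w : ℕ → ℝ,
      e.eval ⟨Function.update σ.reg 1 j, Function.update σ.arr a w⟩ = v j) :
    Runs G τ (sumLoop 1 0 a e) σ (m * (e.cost + 12) + 8)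
      (fun σ' => σ'.arr a 0 = ∑ j, v j ∧ Frame (sumLoop 1 0 a e) σ σ') := by
  refine Runs.frame ?_
  have := runs_sumLoop (G := G) (τ := τ) (i := 1) (n := 0) (a := a) (e := e) (σ := σ)
    (fun k => if h : k < m then v ⟨k, h⟩ else 0) (by decide) (fun k hk w => by
      rw [hm] at hk
      simpa [hk] using he ⟨k, hk⟩ w)
  rw [hm] at this
  refine this.mono le_rfl fun σ' h => h.trans ?_
  rw [← Fin.sum_univ_eq_sum_range (fun k => if h : k < m then v ⟨k, h⟩ else 0)]
  simp

theorem runs_oracleVec {σ : State} {src : ℕ} {v : EuclideanSpace ℝ (Fin m)}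
    (h : σ.Stores src v) (dst : ℕ) :
    Runs G τ (.oracle dst src) σ (m + τ)
      (fun σ' => σ'.Stores dst (G v) ∧ Frame (.oracle dst src) σ σ') := by
  refine Runs.frame (Runs.oracle fun j => ?_)
  rw [h.vec_eq]
  simp [State.setVec]

theorem runs_assignCell {σ : State} (a : ℕ) (e : RExpr) :
    Runs G τ (.setCell a (.lit 0) e) σ (e.cost + 2)
      (fun σ' => σ'.arr a 0 = e.eval σ ∧ Frame (.setCell a (.lit 0) e) σ σ') :=
  ((Runs.setCell (by simp [State.setCell, NExpr.eval])).frame).le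
    (by simp only [NExpr.cost]; lia)

theorem runs_assignReg {σ : State} (r : ℕ) (e : NExpr) :
    Runs G τ (.setReg r e) σ (e.cost + 1)
      (fun σ' => σ'.reg r = e.eval σ ∧ Frame (.setReg r e) σ σ') :=
  (Runs.setReg (by simp [State.setReg])).frame

/-- The problem data, in the arrays where the program finds them. -/
structure Context (c : ℝ) (s : EuclideanSpace ℝ (Fin m)) (ρ : ℝ)
    (z γ : EuclideanSpace ℝ (Fin m)) (ξ : ℝ) (σ : State) : Prop where
  dim : σ.reg 0 = m
  stores_s : σ.Stores 0 s
  stores_z : σ.Stores 1 z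
  stores_γ : σ.Stores 2 γ
  cell_c : σ.arr 3 0 = c
  cell_ρ : σ.arr 3 1 = ρ
  cell_ξ : σ.arr 3 2 = ξ

variable {c ρ ξ : ℝ} {s z γ : EuclideanSpace ℝ (Fin m)}

theorem Context.of_frame {p : Cmd} {σ σ' : State} (h : Context c s ρ z γ ξ σ)
    (hf : Frame p σ σ')
    (hp : (p.writesReg 0 || p.writesArr 0 || p.writesArr 1 || p.writesArr 2 || p.writesArr 3)
      = false) : Context c s ρ z γ ξ σ' := by
  simp only [Bool.or_eq_false_iff] at hp
  obtain ⟨⟨⟨⟨h0, h1⟩, h2⟩, h3⟩, h4⟩ := hp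
  exact ⟨hf.register h.dim h0, hf.stores h.stores_s h1, hf.stores h.stores_z h2,
    hf.stores h.stores_γ h3, hf.cell h.cell_c h4, hf.cell h.cell_ρ h4, hf.cell h.cell_ξ h4⟩

theorem context_initState : Context c s ρ z γ ξ (initState c s ρ z γ ξ) := by
  constructor
  · simp [initState, State.setReg, State.setVec, State.setCell]
  all_goals try intro j
  all_goals simp [initState, State.setReg, State.setVec, State.setCell]

/-- The unit of the time bounds: the order of the time for a projection and an oracle call. -/
def workUnit (m τ : ℕ) : ℕ := m * (Nat.clog 2 (2 * m) + 1) + τ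

theorem le_workUnit (m τ : ℕ) : m + τ ≤ workUnit m τ := by
  have : m * 1 ≤ m * (Nat.clog 2 (2 * m) + 1) := Nat.mul_le_mul_left _ (by lia)
  unfold workUnit
  lia

theorem runs_projectVec {σ : State} {q : EuclideanSpace ℝ (Fin m)} (hm : 0 < m) (hc : 0 < c)
    (hs : ∀ j, 0 < s j) (h : Context c s ρ z γ ξ σ) (hq : σ.Stores 9 q) :
    Runs G τ project σ (1000 * workUnit m τ) (fun σ' =>
      (∃ w, IsProj (feasibleSet c s) q w ∧ σ'.Stores 10 w) ∧ Frame project σ σ') := by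
  refine Runs.frame ?_
  refine (isProj_project hm hc hs h.dim h.stores_s h.cell_c).mono ?_ fun σ' hσ' => ?_
  · exact Nat.mul_le_mul_left _ (Nat.le_add_right _ _)
  · rw [hq.vec_eq] at hσ'
    exact ⟨_, hσ', fun j => rfl⟩

/-! ### The program -/

/-- The gradient of the objective in the point of array `b`, where array `a` has the answer of the
oracle. -/
def gradExpr (a b : ℕ) : RExpr :=
  .add (.sub (.get 2 (.reg 1)) (.get a (.reg 1)))
    (.mul (.get 3 (.lit 1)) (.sub (.get b (.reg 1)) (.get 1 (.reg 1))))

/-- The point on the segment from array `5` to array `6` with parameter `2 / (t + 1)`. -/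
def mixExpr : RExpr :=
  .add (.get 5 (.reg 1)) (.mul (.div (.lit 2) (.ofNat (.add (.reg 3) (.lit 1))))
    (.sub (.get 6 (.reg 1)) (.get 5 (.reg 1))))

/-- One accelerated step from the pair of points in the arrays `5` and `6`. -/
def acceleratedStep : Cmd :=
  .seq (fillLoop 1 0 7 mixExpr) <| .seq (.oracle 8 7) <|
  -- The step size is `t / (4 · 2 M)`: the regularized gradient is `2 M`-Lipschitz once `S ≤ M`.
  .seq (fillLoop 1 0 9 (.sub (.get 6 (.reg 1))
    (.mul (.div (.ofNat (.reg 3)) (.mul (.lit 8) (.get 20 (.lit 0))))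
      (.add (gradExpr 8 7)
        (.sub (.mul (.get 22 (.lit 0)) (.get 7 (.reg 1))) (.get 11 (.reg 1))))))) <|
  .seq project <| .seq (fillLoop 1 0 6 (.get 10 (.reg 1))) <|
  .seq (fillLoop 1 0 5 mixExpr) (.setReg 3 (.add (.reg 3) (.lit 1)))

/-- One stage of recursive regularization. -/
def stage : Cmd :=
  .seq (.setCell 22 (.lit 0) (.add (.get 22 (.lit 0)) (.get 21 (.lit 0)))) <|
  .seq (fillLoop 1 0 11 (.add (.get 11 (.reg 1)) (.mul (.get 21 (.lit 0)) (.get 5 (.reg 1))))) <|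
  .seq (fillLoop 1 0 6 (.get 5 (.reg 1))) <|
  .seq (.setReg 3 (.lit 1)) <|
  .seq (.while (.natLt (.reg 3) (.add (.reg 2) (.lit 1))) acceleratedStep) <|
  .seq (.setCell 21 (.lit 0) (.mul (.lit 4) (.get 21 (.lit 0)))) (.setReg 2 (.half (.reg 2)))

/-- The coordinate of the residual of the gradient step from array `5` to array `4`. -/
def residualExpr : RExpr :=
  .add (.sub (gradExpr 14 4) (gradExpr 8 5))
    (.mul (.get 20 (.lit 0)) (.sub (.get 5 (.reg 1)) (.get 4 (.reg 1))))

/-- A gradient step from array `5` to array `4`, and the test of its residual. -/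
def finalStep : Cmd :=
  .seq (.oracle 8 5) <|
  .seq (fillLoop 1 0 9 (.sub (.get 5 (.reg 1))
    (.mul (.div (.lit 1) (.get 20 (.lit 0))) (gradExpr 8 5)))) <|
  .seq project <| .seq (fillLoop 1 0 4 (.get 10 (.reg 1))) <| .seq (.oracle 14 4) <|
  .seq (sumLoop 1 0 27 (.mul residualExpr residualExpr)) <|
  .ite (.realLe (.mul (.lit 2) (.get 27 (.lit 0))) (.mul (.get 3 (.lit 2)) (.get 3 (.lit 2))))
    (.setReg 5 (.lit 1)) .skip

/-- One attempt, with the smoothness guess in array `20`. -/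
def attempt : Cmd :=
  .seq (.setReg 2 (.reg 4)) <|
  .seq (.setCell 21 (.lit 0) (.div (.get 3 (.lit 2)) (.lit 16))) <|
  .seq (.setCell 22 (.lit 0) (.lit 0)) <| .seq (fillLoop 1 0 11 (.lit 0)) <|
  .seq (.while (.natLt (.lit 1023) (.reg 2)) stage) <| .seq finalStep <|
  .seq (.setCell 20 (.lit 0) (.mul (.lit 4) (.get 20 (.lit 0))))
    (.setReg 4 (.add (.reg 4) (.reg 4)))

/-- The whole program: attempts with growing smoothness guesses. -/
def xUpdate : Cmd :=
  .seq (.setCell 20 (.lit 0) (.get 3 (.lit 2))) <| .seq (.setReg 4 (.lit 1024)) <|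
  .while (.natLt (.reg 5) (.lit 1)) attempt

/-! ### Its analysis -/

/-- Memory layout: arrays `5`, `6`, `7` hold `x`, `u`, `y`; array `8` the oracle's answer; `9` and
`10` input and output of the projection; `11` and `22` the linear term `p` and the Hessian `S` of
the regularizer; `20` the guess `M`. Register `3` is the step index `t`. -/
theorem runs_acceleratedStep {σ : State} {M S : ℝ} {t : ℕ} {p x u : EuclideanSpace ℝ (Fin m)}
    (hm : 0 < m) (hc : 0 < c) (hs : ∀ j, 0 < s j) (ctx : Context c s ρ z γ ξ σ)
    (hM : σ.arr 20 0 = M) (hS : σ.arr 22 0 = S) (ht : σ.reg 3 = t) (hp : σ.Stores 11 p)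
    (hx : σ.Stores 5 x) (hu : σ.Stores 6 u) :
    Runs G τ acceleratedStep σ (1200 * workUnit m τ) (fun σ' => (σ'.reg 3 = t + 1 ∧
      ∃ y x' u', σ'.Stores 5 x' ∧ σ'.Stores 6 u' ∧ y = x + (2 / ((t : ℝ) + 1)) • (u - x) ∧
        IsProj (feasibleSet c s)
          (u - ((t : ℝ) / (4 * (2 * M))) • (objectiveGrad G ρ z γ y + (S • y - p))) u' ∧
        x' = x + (2 / ((t : ℝ) + 1)) • (u' - x)) ∧ Frame acceleratedStep σ σ') := by
  refine Runs.frame ?_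
  have hW := le_workUnit m τ
  set W := workUnit m τ
  set y := x + (2 / ((t : ℝ) + 1)) • (u - x) with hy
  refine ((runs_fillVec ctx.dim 7 mixExpr y fun j w _ => ?_).seq (T' := 1170 * W)
    fun σ₁ ⟨y₁, f₁⟩ => ?_).le ?_
  · simp [mixExpr, RExpr.eval, NExpr.eval, hx j, hu j, ht, hy]
  swap
  · simp only [mixExpr, RExpr.cost, NExpr.cost]; lia
  have ctx₁ := ctx.of_frame f₁ rfl
  refine ((runs_oracleVec y₁ 8).seq (T' := 1160 * W) fun σ₂ ⟨g₂, f₂⟩ => ?_).le (by lia)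
  have ctx₂ := ctx₁.of_frame f₂ rfl
  have u₂ := f₂.stores (f₁.stores hu rfl) rfl
  have y₂ := f₂.stores y₁ rfl
  have p₂ := f₂.stores (f₁.stores hp rfl) rfl
  have t₂ := f₂.register (f₁.register ht rfl) rfl
  have M₂ := f₂.cell (f₁.cell hM rfl) rfl
  have S₂ := f₂.cell (f₁.cell hS rfl) rfl
  refine ((runs_fillVec ctx₂.dim 9 _
    (u - ((t : ℝ) / (4 * (2 * M))) • (objectiveGrad G ρ z γ y + (S • y - p)))
    fun j w _ => ?_).seq (T' := 1100 * W) fun σ₃ ⟨q₃, f₃⟩ => ?_).le ?_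
  · simp [gradExpr, RExpr.eval, NExpr.eval, u₂ j, y₂ j, p₂ j, g₂ j, t₂, M₂, S₂, objectiveGrad,
      ctx₂.stores_γ j, ctx₂.stores_z j, ctx₂.cell_ρ]
    ring
  · simp only [gradExpr, RExpr.cost, NExpr.cost]; lia
  have ctx₃ := ctx₂.of_frame f₃ rfl
  refine ((runs_projectVec hm hc hs ctx₃ q₃).seq (T' := 100 * W)
    fun σ₄ ⟨⟨u', hu', w₄⟩, f₄⟩ => ?_).le (by lia)
  have ctx₄ := ctx₃.of_frame f₄ rfl
  refine ((runs_fillVec ctx₄.dim 6 _ u' fun j w _ => ?_).seq (T' := 80 * W)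
    fun σ₅ ⟨u₅, f₅⟩ => ?_).le ?_
  · simp [RExpr.eval, NExpr.eval, w₄ j]
  · simp only [RExpr.cost, NExpr.cost]; lia
  have ctx₅ := ctx₄.of_frame f₅ rfl
  have x₅ := f₅.stores (f₄.stores (f₃.stores (f₂.stores (f₁.stores hx rfl) rfl) rfl) rfl) rfl
  have t₅ := f₅.register (f₄.register (f₃.register t₂ rfl) rfl) rfl
  refine ((runs_fillVec ctx₅.dim 5 mixExpr (x + (2 / ((t : ℝ) + 1)) • (u' - x))
    fun j w hw => ?_).seq (T' := 4) fun σ₆ ⟨x₆, f₆⟩ => ?_).le ?_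
  · simp [mixExpr, RExpr.eval, NExpr.eval, hw, x₅ j, u₅ j, t₅]
  swap
  · simp only [mixExpr, RExpr.cost, NExpr.cost]; lia
  refine Runs.setReg ⟨?_, y, _, u', x₆, f₆.stores u₅ rfl, rfl, hu', rfl⟩
  have := f₆.register t₅ rfl
  simp [State.setReg, NExpr.eval, this]

end RealRAM

namespace RealRAM

variable {m : ℕ} {G : EuclideanSpace ℝ (Fin m) → EuclideanSpace ℝ (Fin m)} {τ : ℕ}
  {c ρ ξ : ℝ} {s z γ : EuclideanSpace ℝ (Fin m)}

/-- Time bound and feasibility hold for every guess `M`; only the accuracy is conditional on `M`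
being large enough. -/
theorem runs_acceleratedLoop {σ : State} {f : EuclideanSpace ℝ (Fin m) → ℝ} {M S Lf : ℝ} {N : ℕ}
    {p x : EuclideanSpace ℝ (Fin m)} (hm : 0 < m) (hc : 0 < c) (hs : ∀ j, 0 < s j)
    (hf : SmoothConvexOn (feasibleSet c s) f (objectiveGrad G ρ z γ) Lf)
    (ctx : Context c s ρ z γ ξ σ) (hM0 : 0 < M) (hS0 : 0 ≤ S)
    (hM : σ.arr 20 0 = M) (hS : σ.arr 22 0 = S) (hN : σ.reg 2 = N) (ht : σ.reg 3 = 1)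
    (hp : σ.Stores 11 p) (hx : σ.Stores 5 x) (hu : σ.Stores 6 x) (hxZ : x ∈ feasibleSet c s) :
    Runs G τ (.while (.natLt (.reg 3) (.add (.reg 2) (.lit 1))) acceleratedStep) σ
      (N * (1200 * workUnit m τ + 5) + 5) (fun σ' =>
        ∃ x' ∈ feasibleSet c s, σ'.Stores 5 x' ∧ (Lf ≤ M → S ≤ M → ∀ w ∈ feasibleSet c s,
          (N : ℝ) * (N + 1) / 4 * (f x' + (S / 2 * ‖x'‖ ^ 2 - inner ℝ p x') -
            (f w + (S / 2 * ‖w‖ ^ 2 - inner ℝ p w))) ≤ 2 * M * ‖x - w‖ ^ 2)) := by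
  set Z := feasibleSet c s with hZ
  have hconv : Convex ℝ Z := convex_feasibleSet hc
  set F : EuclideanSpace ℝ (Fin m) → ℝ := fun y => f y + (S / 2 * ‖y‖ ^ 2 - inner ℝ p y) with hF
  have key := Runs.while_variant (G := G) (τ := τ) (σ := σ) (T := 1200 * workUnit m τ) (n := N)
    (b := .natLt (.reg 3) (.add (.reg 2) (.lit 1))) (p := acceleratedStep)
    -- The potential of `accelerated_step` telescopes. It starts with `t = 0`, where the weight of
    -- the function gap vanishes, and register `3` is one ahead of the number of completed steps.
    (fun σ' => Frame acceleratedStep σ σ' ∧ ∃ t : ℕ, σ'.reg 3 = t + 1 ∧ t ≤ N ∧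
      ∃ x' ∈ Z, ∃ u ∈ Z, σ'.Stores 5 x' ∧ σ'.Stores 6 u ∧ (Lf ≤ M → S ≤ M → ∀ w ∈ Z,
        (t : ℝ) * (t + 1) / 4 * (F x' - F w) + 2 * M * ‖u - w‖ ^ 2 ≤ 2 * M * ‖x - w‖ ^ 2))
    (fun σ' => N + 1 - σ'.reg 3) ?_ ?_ (by simp [ht])
  · refine key.mono (by simp [BExpr.cost, NExpr.cost]) ?_
    rintro σ' ⟨⟨hfr, t, h3, htN, x', hx', u, hu, hx5, -, hpot⟩, hb⟩
    have h2 := hfr.register hN rfl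
    simp only [BExpr.Holds, NExpr.eval, h3, h2] at hb
    obtain rfl : t = N := by lia
    refine ⟨x', hx', hx5, fun h1 h2 w hw => ?_⟩
    have := hpot h1 h2 w hw
    have h0 : 0 ≤ 2 * M * ‖u - w‖ ^ 2 := by positivity
    simp only [hF] at this
    linarith
  · rintro σ₁ ⟨hfr, t, h3, htN, x₁, hx₁, u₁, hu₁, s5, s6, hpot⟩ hb
    have h2 := hfr.register hN rfl
    simp only [BExpr.Holds, NExpr.eval, h3, h2] at hb
    refine (runs_acceleratedStep hm hc hs (ctx.of_frame hfr rfl) (hfr.cell hM rfl)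
      (hfr.cell hS rfl) h3 (hfr.stores hp rfl) s5 s6).mono le_rfl ?_
    rintro σ₂ ⟨⟨r3, y, x₂, u₂, k5, k6, hy, hu₂, hx₂⟩, hfr₂⟩
    have hr : 2 / (((t + 1 : ℕ) : ℝ) + 1) ∈ Set.Icc (0 : ℝ) 1 := by
      refine ⟨by positivity, (div_le_one (by positivity)).mpr ?_⟩
      push_cast
      have : (0 : ℝ) ≤ t := t.cast_nonneg
      linarith
    have hx₂Z : x₂ ∈ Z := by
      rw [hx₂]; exact hconv.add_smul_sub_mem hx₁ hu₂.1 hr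
    refine ⟨⟨⟨fun r hr => (hfr₂.reg r hr).trans (hfr.reg r hr),
      fun a ha => (hfr₂.arr a ha).trans (hfr.arr a ha)⟩, t + 1, r3, by lia, x₂, hx₂Z, u₂, hu₂.1,
      k5, k6, fun h1 h2 w hw => ?_⟩, by lia⟩
    have hstep := ((hf.mono h1).add_quadratic hS0 p |>.mono
      (show M + S ≤ 2 * M by linarith)).accelerated_step hconv (by linarith)
      (t := ((t + 1 : ℕ) : ℝ)) (by push_cast; have : (0 : ℝ) ≤ t := t.cast_nonneg; linarith)
      hx₁ hu₁ hy hu₂ hx₂ hw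
    have := hpot h1 h2 w hw
    have e : (((t + 1 : ℕ) : ℝ) - 1) * ((t + 1 : ℕ) : ℝ) / 4 = (t : ℝ) * (t + 1) / 4 := by
      push_cast; ring
    rw [e] at hstep
    simp only [hF] at this ⊢
    linarith
  · exact ⟨⟨fun _ _ => rfl, fun _ _ => rfl⟩, 0, ht, by lia, x, hxZ, x, hxZ, hx, hu,
      fun _ _ w _ => by simp⟩

theorem runs_stage {σ : State} {f : EuclideanSpace ℝ (Fin m) → ℝ} {M S Lf a : ℝ} {N : ℕ}
    {p x : EuclideanSpace ℝ (Fin m)} (hm : 0 < m) (hc : 0 < c) (hs : ∀ j, 0 < s j)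
    (hf : SmoothConvexOn (feasibleSet c s) f (objectiveGrad G ρ z γ) Lf)
    (ctx : Context c s ρ z γ ξ σ) (hM0 : 0 < M) (hS0 : 0 ≤ S) (ha0 : 0 ≤ a)
    (hM : σ.arr 20 0 = M) (ha : σ.arr 21 0 = a) (hS : σ.arr 22 0 = S) (hN : σ.reg 2 = N)
    (hp : σ.Stores 11 p) (hx : σ.Stores 5 x) (hxZ : x ∈ feasibleSet c s) :
    Runs G τ stage σ ((N + 1) * (1300 * workUnit m τ)) (fun σ' =>
      (σ'.reg 2 = N / 2 ∧ σ'.arr 21 0 = 4 * a ∧ σ'.arr 22 0 = S + a ∧ σ'.Stores 11 (p + a • x) ∧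
        ∃ x' ∈ feasibleSet c s, σ'.Stores 5 x' ∧ (Lf ≤ M → S + a ≤ M → ∀ w ∈ feasibleSet c s,
          (N : ℝ) * (N + 1) / 4 *
            (f x' + ((S + a) / 2 * ‖x'‖ ^ 2 - inner ℝ (p + a • x) x') -
              (f w + ((S + a) / 2 * ‖w‖ ^ 2 - inner ℝ (p + a • x) w))) ≤
          2 * M * ‖x - w‖ ^ 2)) ∧ Frame stage σ σ') := by
  refine Runs.frame ?_
  have hW := le_workUnit m τ
  set W := workUnit m τ with hWdef
  have hNW : N ≤ N * W := Nat.le_mul_of_pos_right _ (by lia)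
  have eT : (N + 1) * (1300 * W) = 1300 * (N * W) + 1300 * W := by ring
  have eL : N * (1200 * W + 5) = 1200 * (N * W) + 5 * N := by ring
  rw [eT]
  refine ((runs_assignCell 22 _).seq (T' := 1300 * (N * W) + 1290 * W)
    fun σ₁ ⟨w₁, f₁⟩ => ?_).le (by simp only [RExpr.cost, NExpr.cost]; lia)
  simp only [RExpr.eval, NExpr.eval, hS, ha] at w₁
  have ctx₁ := ctx.of_frame f₁ rfl
  have a₁ := f₁.cell ha rfl
  have x₁ := f₁.stores hx rfl
  have p₁ := f₁.stores hp rfl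
  refine ((runs_fillVec ctx₁.dim 11
    (.add (.get 11 (.reg 1)) (.mul (.get 21 (.lit 0)) (.get 5 (.reg 1)))) (p + a • x)
    fun j w hw => ?_).seq (T' := 1300 * (N * W) + 1250 * W) fun σ₂ ⟨w₂, f₂⟩ => ?_).le (by
      simp only [RExpr.cost, NExpr.cost]; lia)
  · simp [RExpr.eval, NExpr.eval, hw, p₁ j, x₁ j, a₁]
  have ctx₂ := ctx₁.of_frame f₂ rfl
  have x₂ := f₂.stores x₁ rfl
  refine ((runs_fillVec ctx₂.dim 6 (.get 5 (.reg 1)) x fun j w _ => ?_).seq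
    (T' := 1300 * (N * W) + 1230 * W) fun σ₃ ⟨w₃, f₃⟩ => ?_).le (by
      simp only [RExpr.cost, NExpr.cost]; lia)
  · simp [RExpr.eval, NExpr.eval, x₂ j]
  have ctx₃ := ctx₂.of_frame f₃ rfl
  refine ((runs_assignReg 3 (.lit 1)).seq (T' := 1300 * (N * W) + 1220 * W)
    fun σ₄ ⟨w₄, f₄⟩ => ?_).le (by simp only [NExpr.cost]; lia)
  have ctx₄ := ctx₃.of_frame f₄ rfl
  have fr {r v : ℕ} (h : σ.reg r = v)
      (hr : r ≠ 1 ∧ r ≠ 3) : σ₄.reg r = v := by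
    have h1 : (r == 1) = false := by simpa using hr.1
    have h3 : (r == 3) = false := by simpa using hr.2
    refine f₄.register (f₃.register (f₂.register (f₁.register h ?_) ?_) ?_) ?_ <;>
      simp [Cmd.writesReg, fillLoop, forLoop, h1, h3]
  have S₄ := f₄.cell (f₃.cell (f₂.cell w₁ rfl) rfl) rfl
  have M₄ := f₄.cell (f₃.cell (f₂.cell (f₁.cell hM rfl) rfl) rfl) rfl
  have a₄ := f₄.cell (f₃.cell (f₂.cell a₁ rfl) rfl) rfl
  have p₄ := f₄.stores (f₃.stores w₂ rfl) rfl
  have N₄ : σ₄.reg 2 = N := fr hN (by decide)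
  refine ((runs_acceleratedLoop hm hc hs hf ctx₄ hM0 (add_nonneg hS0 ha0) M₄ S₄ N₄ w₄ p₄
    (f₄.stores (f₃.stores x₂ rfl) rfl) (f₄.stores w₃ rfl) hxZ).frame.seq (T' := 20)
    fun σ₅ ⟨⟨x', hx', s5, hacc⟩, f₅⟩ => ?_).le (by lia)
  have S₅ := f₅.cell S₄ rfl
  have a₅ := f₅.cell a₄ rfl
  have p₅ := f₅.stores p₄ rfl
  have N₅ := f₅.register N₄ rfl
  refine ((runs_assignCell 21 _).seq (T' := 3) fun σ₆ ⟨w₆, f₆⟩ => ?_).le (by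
    simp only [RExpr.cost, NExpr.cost]; lia)
  have N₆ := f₆.register N₅ rfl
  refine (runs_assignReg 2 _).mono (by simp only [NExpr.cost]; lia) ?_
  rintro σ₇ ⟨w₇, f₇⟩
  refine ⟨by rw [w₇, NExpr.eval, NExpr.eval, N₆], f₇.cell ?_ rfl, f₇.cell (f₆.cell S₅ rfl) rfl,
    f₇.stores (f₆.stores p₅ rfl) rfl, x', hx', f₇.stores (f₆.stores s5 rfl) rfl, hacc⟩
  rw [w₆]
  simp [RExpr.eval, NExpr.eval, a₅]

/-- Halving `N` and quadrupling the modulus keeps `N² σ` constant. Register `2` is `512 · 2 ^ (j + 1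
- k)` before stage `k`, so the threshold 1023 stops the loop exactly at `k = j + 1`. The potential
is proportional to `N`: its halving pays for the stage. -/
theorem runs_stages {σ : State} {f : EuclideanSpace ℝ (Fin m) → ℝ} {M Lf : ℝ} {j : ℕ}
    {x : EuclideanSpace ℝ (Fin m)} (hm : 0 < m) (hc : 0 < c) (hs : ∀ j, 0 < s j) (hξ : 0 < ξ)
    (hf : SmoothConvexOn (feasibleSet c s) f (objectiveGrad G ρ z γ) Lf)
    (ctx : Context c s ρ z γ ξ σ) (hMj : M = 4 ^ j * ξ)
    (hM : σ.arr 20 0 = M) (ha : σ.arr 21 0 = ξ / 16) (hS : σ.arr 22 0 = 0)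
    (hN : σ.reg 2 = 1024 * 2 ^ j)
    (hp : σ.Stores 11 (0 : EuclideanSpace ℝ (Fin m))) (hx : σ.Stores 5 x)
    (hxZ : x ∈ feasibleSet c s) :
    Runs G τ (.while (.natLt (.lit 1023) (.reg 2)) stage) σ
      (1024 * 2 ^ j * (3000 * workUnit m τ) + 3) (fun σ' =>
        ∃ x' ∈ feasibleSet c s, σ'.Stores 5 x' ∧ (Lf ≤ M → ∃ S p,
          StageInv (feasibleSet c s) (objectiveGrad G ρ z γ) (ξ / 16) √2 (j + 1) x' S p)) := by
  set Z := feasibleSet c s with hZ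
  have hconv : Convex ℝ Z := convex_feasibleSet hc
  have hcomp : IsCompact Z := isCompact_feasibleSet hc
  have hM0 : 0 < M := by rw [hMj]; positivity
  have hW := le_workUnit m τ
  set W := workUnit m τ with hWdef
  have key := Runs.while_potential (G := G) (τ := τ) (σ := σ)
    (b := .natLt (.lit 1023) (.reg 2)) (p := stage)
    (fun σ' => Frame stage σ σ' ∧ ∃ k ≤ j + 1, σ'.reg 2 = 512 * 2 ^ (j + 1 - k) ∧
      σ'.arr 21 0 = 4 ^ k * (ξ / 16) ∧ ∃ S p, ∃ x' ∈ Z, σ'.arr 22 0 = S ∧ σ'.Stores 11 p ∧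
        σ'.Stores 5 x' ∧ 0 ≤ S ∧
        (Lf ≤ M → StageInv Z (objectiveGrad G ρ z γ) (ξ / 16) √2 k x' S p))
    (fun σ' => σ'.reg 2 * (3000 * W)) ?_ ?_
  · refine key.mono (by simp [BExpr.cost, NExpr.cost, hN]) ?_
    rintro σ' ⟨⟨hfr, k, hk, h2, -, S, p, x', hx', -, -, h5, -, hinv⟩, hb⟩
    simp only [BExpr.Holds, NExpr.eval, h2] at hb
    obtain rfl : k = j + 1 := by
      by_contra hne
      have : 2 ^ 1 ≤ 2 ^ (j + 1 - k) := Nat.pow_le_pow_right (by lia) (by lia)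
      lia
    exact ⟨x', hx', h5, fun h => ⟨S, p, hinv h⟩⟩
  · rintro σ₁ ⟨hfr, k, hk, h2, h21, S, p, x₁, hx₁, h22, h11, h5, hS0, hinv⟩ hb
    simp only [BExpr.Holds, NExpr.eval, h2] at hb
    have hkj : k ≤ j := by
      by_contra hne
      have : j + 1 - k = 0 := by lia
      rw [this] at hb
      lia
    obtain ⟨i, rfl⟩ := Nat.exists_eq_add_of_le hkj
    have ei : k + i + 1 - k = i + 1 := by lia
    rw [ei] at h2 hb
    refine ⟨_, (runs_stage hm hc hs hf (ctx.of_frame hfr rfl) hM0 hS0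
      (a := 4 ^ k * (ξ / 16)) (by positivity) (hfr.cell hM rfl) h21 h22 h2 h11 h5 hx₁).mono
      le_rfl ?_⟩
    rintro σ₂ ⟨⟨g2, g21, g22, g11, x₂, hx₂, g5, hacc⟩, hfr₂⟩
    refine ⟨⟨⟨fun r hr => (hfr₂.reg r hr).trans (hfr.reg r hr),
      fun b hb => (hfr₂.arr b hb).trans (hfr.arr b hb)⟩, k + 1, by lia, ?_, ?_, _, _, x₂, hx₂, g22,
      g11, g5, by positivity, fun hL => ?_⟩, ?_⟩
    · have e : k + i + 1 - (k + 1) = i := by lia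
      rw [g2, e, pow_succ]
      lia
    · rw [g21, pow_succ]; ring
    · have hi := hinv hL
      -- The sum is at most `4 ^ k ξ (1/48 + 1/16) = 4 ^ k ξ / 12`.
      have hSM : S + 4 ^ k * (ξ / 16) ≤ M := by
        have h1 := hi.le
        have h2 : (4 : ℝ) ^ k * ξ ≤ M := by
          rw [hMj]
          gcongr
          · norm_num
        have h3 : 0 < (4 : ℝ) ^ k * ξ := by positivity
        linarith
      refine hi.succ (hf.mono hL) hcomp hconv (by positivity) (by positivity) hM0
        (Nat.cast_nonneg _) (le_of_eq ?_) hx₂ (hacc hL hSM)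
      rw [hMj]
      push_cast
      rw [mul_pow, ← pow_mul, mul_comm (i + 1) 2, pow_mul, pow_succ, pow_add]
      norm_num
      ring
    · have e : 512 * 2 ^ (i + 1) / 2 = 512 * 2 ^ i := by rw [pow_succ]; lia
      have e2 : 512 * 2 ^ (i + 1) = 2 * (512 * 2 ^ i) := by rw [pow_succ]; ring
      simp only [g2, h2, e, BExpr.cost, NExpr.cost]
      have hi : 1 ≤ 2 ^ i := Nat.one_le_two_pow
      rw [e2]
      generalize 2 ^ i = q at hi
      have h1 : W ≤ q * W := Nat.le_mul_of_pos_left _ hi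
      have e3 : 512 * q * (3000 * W) = 1536000 * (q * W) := by ring
      have e4 : (2 * (512 * q) + 1) * (1300 * W) = 1331200 * (q * W) + 1300 * W := by ring
      have e5 : 2 * (512 * q) * (3000 * W) = 3072000 * (q * W) := by ring
      lia
  · exact ⟨⟨fun _ _ => rfl, fun _ _ => rfl⟩, 0, by lia, by rw [hN, Nat.sub_zero, pow_succ]; ring,
      by simpa using ha, 0, 0, x, hxZ, hS, hp, hx, le_rfl, fun hL => StageInv.zero hf hcomp hconv
        (by positivity) hxZ fun a ha b hb => norm_sub_le_sqrt_two hc ha hb⟩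

theorem runs_finalStep {σ : State} {M : ℝ} {x : EuclideanSpace ℝ (Fin m)} (hm : 0 < m)
    (hc : 0 < c) (hs : ∀ j, 0 < s j) (ctx : Context c s ρ z γ ξ σ)
    (hM : σ.arr 20 0 = M) (h5 : σ.reg 5 = 0) (hx : σ.Stores 5 x) :
    Runs G τ finalStep σ (1300 * workUnit m τ) (fun σ' => (∃ x', σ'.Stores 4 x' ∧
      IsProj (feasibleSet c s) (x - (1 / M) • objectiveGrad G ρ z γ x) x' ∧
      ((σ'.reg 5 = 1 ∧ 2 * ‖objectiveGrad G ρ z γ x' - objectiveGrad G ρ z γ x +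
          M • (x - x')‖ ^ 2 ≤ ξ * ξ) ∨
        (σ'.reg 5 = 0 ∧ ¬ 2 * ‖objectiveGrad G ρ z γ x' - objectiveGrad G ρ z γ x +
          M • (x - x')‖ ^ 2 ≤ ξ * ξ))) ∧ Frame finalStep σ σ') := by
  refine Runs.frame ?_
  have hW := le_workUnit m τ
  set W := workUnit m τ with hWdef
  refine ((runs_oracleVec hx 8).seq (T' := 1290 * W) fun σ₁ ⟨g₁, f₁⟩ => ?_).le (by lia)
  have ctx₁ := ctx.of_frame f₁ rfl
  have x₁ := f₁.stores hx rfl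
  have M₁ := f₁.cell hM rfl
  refine ((runs_fillVec ctx₁.dim 9 (.sub (.get 5 (.reg 1))
    (.mul (.div (.lit 1) (.get 20 (.lit 0))) (gradExpr 8 5)))
    (x - (1 / M) • objectiveGrad G ρ z γ x) fun j w _ => ?_).seq (T' := 1240 * W)
    fun σ₂ ⟨q₂, f₂⟩ => ?_).le (by simp only [gradExpr, RExpr.cost, NExpr.cost]; lia)
  · simp [gradExpr, RExpr.eval, NExpr.eval, x₁ j, g₁ j, M₁, objectiveGrad, ctx₁.stores_γ j,
      ctx₁.stores_z j, ctx₁.cell_ρ]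
    ring
  have ctx₂ := ctx₁.of_frame f₂ rfl
  refine ((runs_projectVec hm hc hs ctx₂ q₂).seq (T' := 240 * W)
    fun σ₃ ⟨⟨x', hx', w₃⟩, f₃⟩ => ?_).le (by lia)
  have ctx₃ := ctx₂.of_frame f₃ rfl
  refine ((runs_fillVec ctx₃.dim 4 (.get 10 (.reg 1)) x' fun j w _ => ?_).seq (T' := 220 * W)
    fun σ₄ ⟨x₄, f₄⟩ => ?_).le (by simp only [RExpr.cost, NExpr.cost]; lia)
  · simp [RExpr.eval, NExpr.eval, w₃ j]
  have ctx₄ := ctx₃.of_frame f₄ rfl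
  refine ((runs_oracleVec x₄ 14).seq (T' := 210 * W) fun σ₅ ⟨g₅, f₅⟩ => ?_).le (by lia)
  have ctx₅ := ctx₄.of_frame f₅ rfl
  have s4 := f₅.stores x₄ rfl
  have s5 := f₅.stores (f₄.stores (f₃.stores (f₂.stores x₁ rfl) rfl) rfl) rfl
  have s8 := f₅.stores (f₄.stores (f₃.stores (f₂.stores g₁ rfl) rfl) rfl) rfl
  have M₅ := f₅.cell (f₄.cell (f₃.cell (f₂.cell M₁ rfl) rfl) rfl) rfl
  have r₅ := f₅.register (f₄.register (f₃.register (f₂.register (f₁.register h5 rfl) rfl) rfl) rfl)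
    rfl
  set r := objectiveGrad G ρ z γ x' - objectiveGrad G ρ z γ x + M • (x - x') with hr
  refine ((runs_sumVec ctx₅.dim 27 (.mul residualExpr residualExpr) (fun j => r j * r j)
    fun j w => ?_).seq (T' := 20) fun σ₆ ⟨n₆, f₆⟩ => ?_).le (by
      simp only [residualExpr, gradExpr, RExpr.cost, NExpr.cost]; lia)
  · simp [residualExpr, gradExpr, RExpr.eval, NExpr.eval, s4 j, s5 j, s8 j, g₅ j, M₅,
      objectiveGrad, ctx₅.stores_γ j, ctx₅.stores_z j, ctx₅.cell_ρ, hr]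
  have n₆' : σ₆.arr 27 0 = ‖r‖ ^ 2 := by
    rw [n₆, EuclideanSpace.real_norm_sq_eq]
    exact Finset.sum_congr rfl fun j _ => (pow_two _).symm
  have ξ₆ := f₆.cell ctx₅.cell_ξ rfl
  have x₆ := f₆.stores s4 rfl
  refine (Runs.ite (T := 2) (fun hb => ?_) (fun hb => ?_)).le (by
    simp only [BExpr.cost, RExpr.cost, NExpr.cost]; lia)
  · simp only [BExpr.Holds, RExpr.eval, NExpr.eval, n₆', ξ₆] at hb
    refine Runs.setReg ⟨x', x₆, hx', .inl ⟨by simp [State.setReg, NExpr.eval], ?_⟩⟩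
    exact_mod_cast hb
  · simp only [BExpr.Holds, RExpr.eval, NExpr.eval, n₆', ξ₆] at hb
    refine (Runs.skip ⟨x', x₆, hx', .inr ⟨f₆.register r₅ rfl, ?_⟩⟩).le (by lia)
    exact_mod_cast hb

/-- Success is certified by the test alone, whatever the guess; failure is impossible if `M ≥ Lf`.
-/
theorem runs_attempt {σ : State} {f : EuclideanSpace ℝ (Fin m) → ℝ} {M Lf : ℝ} {j : ℕ}
    {x : EuclideanSpace ℝ (Fin m)} (hm : 0 < m) (hc : 0 < c) (hs : ∀ j, 0 < s j) (hξ : 0 < ξ)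
    (hf : SmoothConvexOn (feasibleSet c s) f (objectiveGrad G ρ z γ) Lf)
    (ctx : Context c s ρ z γ ξ σ) (hMj : M = 4 ^ j * ξ)
    (hM : σ.arr 20 0 = M) (h4 : σ.reg 4 = 1024 * 2 ^ j) (h5 : σ.reg 5 = 0) (hx : σ.Stores 5 x)
    (hxZ : x ∈ feasibleSet c s) :
    Runs G τ attempt σ (1024 * 2 ^ j * (3010 * workUnit m τ)) (fun σ' =>
      (σ'.arr 20 0 = 4 * M ∧ σ'.reg 4 = 1024 * 2 ^ (j + 1) ∧
        (∃ x' ∈ feasibleSet c s, σ'.Stores 5 x') ∧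
        ((σ'.reg 5 = 1 ∧ ∃ x' ∈ feasibleSet c s, σ'.Stores 4 x' ∧ ∀ y ∈ feasibleSet c s,
            inner ℝ (y - x') (-objectiveGrad G ρ z γ x') ≤ ξ) ∨
          (σ'.reg 5 = 0 ∧ M < Lf))) ∧ Frame attempt σ σ') := by
  refine Runs.frame ?_
  have hW := le_workUnit m τ
  set W := workUnit m τ with hWdef
  have hM0 : 0 < M := by rw [hMj]; positivity
  have hq : 1 ≤ 2 ^ j := Nat.one_le_two_pow
  have hqW : W ≤ 2 ^ j * W := Nat.le_mul_of_pos_left _ hq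
  have e1 : 1024 * 2 ^ j * (3010 * W) = 1024 * 3010 * (2 ^ j * W) := by ring
  have e2 : 1024 * 2 ^ j * (3000 * W) = 1024 * 3000 * (2 ^ j * W) := by ring
  rw [e1]
  refine ((runs_assignReg 2 _).seq (T' := 1024 * 3000 * (2 ^ j * W) + 10000 * W)
    fun σ₁ ⟨w₁, f₁⟩ => ?_).le (by simp only [NExpr.cost]; lia)
  simp only [NExpr.eval, h4] at w₁
  have ctx₁ := ctx.of_frame f₁ rfl
  refine ((runs_assignCell 21 _).seq (T' := 1024 * 3000 * (2 ^ j * W) + 9000 * W)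
    fun σ₂ ⟨w₂, f₂⟩ => ?_).le (by simp only [RExpr.cost, NExpr.cost]; lia)
  simp only [RExpr.eval, NExpr.eval, ctx₁.cell_ξ, Rat.cast_ofNat] at w₂
  refine ((runs_assignCell 22 _).seq (T' := 1024 * 3000 * (2 ^ j * W) + 8000 * W)
    fun σ₃ ⟨w₃, f₃⟩ => ?_).le (by simp only [RExpr.cost]; lia)
  simp only [RExpr.eval, Rat.cast_zero] at w₃
  have ctx₃ := (ctx₁.of_frame f₂ rfl).of_frame f₃ rfl
  refine ((runs_fillVec ctx₃.dim 11 (.lit 0) 0 fun j w _ => ?_).seq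
    (T' := 1024 * 3000 * (2 ^ j * W) + 7000 * W) fun σ₄ ⟨w₄, f₄⟩ => ?_).le (by
      simp only [RExpr.cost]; lia)
  · simp [RExpr.eval]
  have ctx₄ := ctx₃.of_frame f₄ rfl
  have M₄ := f₄.cell (f₃.cell (f₂.cell (f₁.cell hM rfl) rfl) rfl) rfl
  have N₄ := f₄.register (f₃.register (f₂.register w₁ rfl) rfl) rfl
  have r4 := f₄.register (f₃.register (f₂.register (f₁.register h4 rfl) rfl) rfl) rfl
  have r5 := f₄.register (f₃.register (f₂.register (f₁.register h5 rfl) rfl) rfl) rfl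
  have x₄ := f₄.stores (f₃.stores (f₂.stores (f₁.stores hx rfl) rfl) rfl) rfl
  refine ((runs_stages hm hc hs hξ hf ctx₄ hMj M₄ (f₄.cell (f₃.cell w₂ rfl) rfl)
    (f₄.cell w₃ rfl) N₄ w₄ x₄ hxZ).frame.seq (T' := 6000 * W)
    fun σ₅ ⟨⟨x₅, hx₅, s₅, hinv⟩, f₅⟩ => ?_).le (by lia)
  have ctx₅ := ctx₄.of_frame f₅ rfl
  refine ((runs_finalStep hm hc hs ctx₅ (f₅.cell M₄ rfl) (f₅.register r5 rfl) s₅).seq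
    (T' := 1000 * W) fun σ₆ ⟨⟨x', s4, hproj, hcase⟩, f₆⟩ => ?_).le (by lia)
  refine ((runs_assignCell 20 _).seq (T' := 4) fun σ₇ ⟨w₇, f₇⟩ => ?_).le (by
    simp only [RExpr.cost, NExpr.cost]; lia)
  simp only [RExpr.eval, NExpr.eval, f₆.cell (f₅.cell M₄ rfl) rfl, Rat.cast_ofNat] at w₇
  have r4' := f₇.register (f₆.register (f₅.register r4 rfl) rfl) rfl
  refine (runs_assignReg 4 _).mono (by simp only [NExpr.cost]; lia) ?_
  rintro σ₈ ⟨w₈, f₈⟩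
  refine ⟨f₈.cell w₇ rfl, ?_, ⟨x₅, hx₅, f₈.stores (f₇.stores (f₆.stores s₅ rfl) rfl) rfl⟩, ?_⟩
  · rw [w₈]
    simp only [NExpr.eval, r4', pow_succ]
    ring
  rcases hcase with ⟨g5, hle⟩ | ⟨g5, hnle⟩
  · refine .inl ⟨f₈.register (f₇.register g5 rfl) rfl, x', hproj.1,
      f₈.stores (f₇.stores s4 rfl) rfl, fun y hy => ?_⟩
    refine (hproj.inner_le_norm_residual hM0 hy).trans ?_
    refine (mul_le_mul_of_nonneg_right (norm_sub_le_sqrt_two hc hy hproj.1)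
      (norm_nonneg _)).trans ?_
    refine le_of_sq_le_sq ?_ hξ.le
    rw [mul_pow, Real.sq_sqrt zero_le_two]
    linarith
  · refine .inr ⟨f₈.register (f₇.register g5 rfl) rfl, ?_⟩
    by_contra hL
    obtain ⟨S, p, hst⟩ := hinv (not_lt.mp hL)
    have hres := hst.norm_residual_le (hf.mono (not_lt.mp hL)) hM0 hξ (by positivity) hMj hx₅ hproj
    apply hnle
    have h1 := pow_le_pow_left₀ (norm_nonneg _) hres 2
    -- Twice this is `100/256 · ξ²`, below the threshold of the test.
    have h2 : (5 / 16 * ξ * √2) ^ 2 = 50 / 256 * (ξ * ξ) := by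
      rw [mul_pow, Real.sq_sqrt zero_le_two]; ring
    have h3 := mul_pos hξ hξ
    linarith

theorem runs_xUpdate {f : EuclideanSpace ℝ (Fin m) → ℝ} {Lf : ℝ} {J : ℕ} (hm : 0 < m)
    (hc : 0 < c) (hs : ∀ j, 0 < s j) (hξ : 0 < ξ)
    (hf : SmoothConvexOn (feasibleSet c s) f (objectiveGrad G ρ z γ) Lf)
    (hJ : Lf ≤ 4 ^ J * ξ) :
    Runs G τ xUpdate (initState c s ρ z γ ξ) (10000000 * (2 ^ J * workUnit m τ)) (fun σ' =>
      ∃ x' ∈ feasibleSet c s, σ'.Stores 4 x' ∧ ∀ y ∈ feasibleSet c s,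
        inner ℝ (y - x') (-objectiveGrad G ρ z γ x') ≤ ξ) := by
  have hW := le_workUnit m τ
  set W := workUnit m τ with hWdef
  have hq : 1 ≤ 2 ^ J := Nat.one_le_two_pow
  have hqW : W ≤ 2 ^ J * W := Nat.le_mul_of_pos_left _ hq
  have ctx : Context c s ρ z γ ξ (initState c s ρ z γ ξ) := context_initState
  have h5 : (initState c s ρ z γ ξ).reg 5 = 0 := by
    simp [initState, State.setReg, State.setVec, State.setCell]
  have hx : (initState c s ρ z γ ξ).Stores 5 (0 : EuclideanSpace ℝ (Fin m)) := fun j => by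
    simp [initState, State.setReg, State.setVec, State.setCell]
  refine ((runs_assignCell 20 _).seq (T' := 9000000 * (2 ^ J * W)) fun σ₁ ⟨w₁, f₁⟩ => ?_).le (by
    simp only [RExpr.cost, NExpr.cost]; lia)
  simp only [RExpr.eval, NExpr.eval, ctx.cell_ξ] at w₁
  have ctx₁ := ctx.of_frame f₁ rfl
  refine ((runs_assignReg 4 _).seq (T' := 8000000 * (2 ^ J * W)) fun σ₂ ⟨w₂, f₂⟩ => ?_).le (by
    simp only [NExpr.cost]; lia)
  simp only [NExpr.eval] at w₂
  have ctx₂ := ctx₁.of_frame f₂ rfl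
  have key := Runs.while_potential (G := G) (τ := τ) (σ := σ₂)
    (b := .natLt (.reg 5) (.lit 1)) (p := attempt)
    (fun σ' => Context c s ρ z γ ξ σ' ∧
      ((σ'.reg 5 = 1 ∧ ∃ x' ∈ feasibleSet c s, σ'.Stores 4 x' ∧ ∀ y ∈ feasibleSet c s,
        inner ℝ (y - x') (-objectiveGrad G ρ z γ x') ≤ ξ) ∨
      (σ'.reg 5 = 0 ∧ ∃ j ≤ J, σ'.arr 20 0 = 4 ^ j * ξ ∧ σ'.reg 4 = 1024 * 2 ^ j ∧
        ∃ x' ∈ feasibleSet c s, σ'.Stores 5 x')))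
    -- Register `4` holds `1024 · 2 ^ j`, and the cost of a run is proportional to it. As the
    -- register doubles, its increase pays for the run; the total budget `2 · 1024 · 2 ^ J` covers
    -- the geometric series.
    (fun σ' => if σ'.reg 5 = 1 then 0 else (2 * (1024 * 2 ^ J) - σ'.reg 4) * (3011 * W)) ?_ ?_
  · refine key.mono ?_ ?_
    · have h5 : ¬ σ₂.reg 5 = 1 := by
        rw [f₂.register (f₁.register h5 rfl) rfl]
        decide
      simp only [h5, if_false, BExpr.cost, NExpr.cost]
      have : (2 * (1024 * 2 ^ J) - σ₂.reg 4) * (3011 * W) ≤ 2 * (1024 * 2 ^ J) * (3011 * W) :=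
        Nat.mul_le_mul_right _ (Nat.sub_le _ _)
      have e : 2 * (1024 * 2 ^ J) * (3011 * W) = 6166528 * (2 ^ J * W) := by ring
      lia
    · rintro σ' ⟨⟨-, h | h⟩, hb⟩
      · exact h.2
      · simp [BExpr.Holds, NExpr.eval, h.1] at hb
  · rintro σ₃ ⟨ctx₃, h | ⟨h0, j, hj, h20, h4, x, hx, s5⟩⟩ hb
    · simp [BExpr.Holds, NExpr.eval, h.1] at hb
    refine ⟨_, (runs_attempt hm hc hs hξ hf ctx₃ rfl h20 h4 h0 s5 hx).mono le_rfl ?_⟩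
    rintro σ₄ ⟨⟨g20, g4, gx, hcase⟩, f₄⟩
    have hjJ : 2 ^ j ≤ 2 ^ J := Nat.pow_le_pow_right (by lia) hj
    have hqj : 1 ≤ 2 ^ j := Nat.one_le_two_pow
    have hjW : W ≤ 2 ^ j * W := Nat.le_mul_of_pos_left _ hqj
    have hn1 : ¬ σ₃.reg 5 = 1 := by lia
    have eT : 1024 * 2 ^ j * (3010 * W) + 3 ≤ 1024 * 2 ^ j * (3011 * W) := by
      have e1 : 1024 * 2 ^ j * (3010 * W) = 3082240 * (2 ^ j * W) := by ring
      have e2 : 1024 * 2 ^ j * (3011 * W) = 3083264 * (2 ^ j * W) := by ring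
      lia
    have eM : 1024 * 2 ^ j * (3011 * W) ≤ (2 * (1024 * 2 ^ J) - 1024 * 2 ^ j) * (3011 * W) :=
      Nat.mul_le_mul_right _ (by lia)
    rcases hcase with ⟨g5, hgood⟩ | ⟨g5, hlt⟩
    · refine ⟨⟨ctx₃.of_frame f₄ rfl, .inl ⟨g5, hgood⟩⟩, ?_⟩
      simp only [g5, hn1, if_true, if_false, h4, BExpr.cost, NExpr.cost]
      lia
    · have hlt' : j < J := by
        refine lt_of_le_of_ne hj ?_
        rintro rfl
        linarith
      have hjJ' : 2 ^ (j + 1) ≤ 2 ^ J := Nat.pow_le_pow_right (by lia) hlt'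
      refine ⟨⟨ctx₃.of_frame f₄ rfl, .inr ⟨g5, j + 1, hlt', ?_, g4, gx⟩⟩, ?_⟩
      · rw [g20, pow_succ]; ring
      · have hn2 : ¬ σ₄.reg 5 = 1 := by lia
        simp only [hn1, hn2, if_false, h4, g4, BExpr.cost, NExpr.cost]
        have : (2 * (1024 * 2 ^ J) - 1024 * 2 ^ (j + 1)) * (3011 * W) + 1024 * 2 ^ j * (3011 * W) =
            (2 * (1024 * 2 ^ J) - 1024 * 2 ^ j) * (3011 * W) := by
          rw [← add_mul]
          congr 1
          rw [pow_succ] at hjJ' ⊢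
          lia
        lia
  · exact ⟨ctx₂, .inr ⟨f₂.register (f₁.register h5 rfl) rfl, 0, by lia,
      by simpa using f₂.cell w₁ rfl, by simpa using w₂, 0, zero_mem_feasibleSet hs,
      f₂.stores (f₁.stores hx rfl) rfl⟩⟩

end RealRAM

/-! ### Logarithms, powers of four, and the main theorem -/

theorem clog_two_mul_le {m : ℕ} (hm : 0 < m) :
    (Nat.clog 2 (2 * m) + 1 : ℝ) ≤ 5 * max 1 (Real.log m) := by
  have h1 : Nat.clog 2 (2 * m) ≤ Nat.log 2 m + 2 := by
    refine Nat.clog_le_of_le_pow ?_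
    have := Nat.lt_pow_succ_log_self one_lt_two m
    rw [pow_succ]
    lia
  -- Uses `log 2 > 1/2`. With the additive 3 from `h1` and the successor this gives the constant 5.
  have h2 : (Nat.log 2 m : ℝ) ≤ 2 * Real.log m := by
    have h3 : (2 : ℝ) ^ Nat.log 2 m ≤ m := by exact_mod_cast Nat.pow_log_le_self 2 hm.ne'
    have h4 := Real.log_le_log (by positivity) h3
    rw [Real.log_pow] at h4
    have h5 := Real.log_two_gt_d9
    have h6 : (0 : ℝ) ≤ Nat.log 2 m := Nat.cast_nonneg _
    nlinarith
  have h3 : (Nat.clog 2 (2 * m) : ℝ) ≤ Nat.log 2 m + 2 := by exact_mod_cast h1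
  have h4 := le_max_left 1 (Real.log m)
  have h5 := le_max_right 1 (Real.log m)
  linarith

/-- A power of four dominates `x`, with its square root of the order of `√x`. -/
theorem exists_le_four_pow (x : ℝ) : ∃ J : ℕ, x ≤ 4 ^ J ∧ (2 : ℝ) ^ J ≤ 2 * max 1 (√x) := by
  have hex : ∃ J : ℕ, x ≤ 4 ^ J := (pow_unbounded_of_one_lt x (by norm_num)).imp fun _ h => h.le
  refine ⟨Nat.find hex, Nat.find_spec hex, ?_⟩
  rcases h : Nat.find hex with _ | j
  · have := le_max_left 1 (√x)
    simp
    linarith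
  · have hj : ¬ x ≤ 4 ^ j := Nat.find_min hex (by lia)
    have h1 : (2 : ℝ) ^ j ≤ √x := by
      refine Real.le_sqrt_of_sq_le ?_
      rw [← pow_mul, mul_comm j 2, pow_mul]
      norm_num
      linarith
    rw [pow_succ]
    linarith [le_max_right 1 (√x)]

theorem mainTheorem12 :
    ∃ prog : RealRAM.Cmd, ∀ κ : ℝ, ∃ C : ℝ,
      ∀ (m : ℕ) (c : ℝ) (s : EuclideanSpace ℝ (Fin m)) (β υ ρ L ξ : ℝ)
        (U : EuclideanSpace ℝ (Fin m) → ℝ) (z γ : EuclideanSpace ℝ (Fin m))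
        (G : EuclideanSpace ℝ (Fin m) → EuclideanSpace ℝ (Fin m)) (τ : ℕ),
        0 < m → 0 < c → (∀ j, 0 < s j) → 0 < υ → 0 < ρ → 0 < ξ →
        IsUtility (feasibleSet c s) β U →
        (∀ x ∈ feasibleSet c s, ∀ y ∈ feasibleSet c s,
          ‖gradientWithin (smoothedLog U υ) (feasibleSet c s) x -
            gradientWithin (smoothedLog U υ) (feasibleSet c s) y‖ ≤ L * ‖x - y‖) →
        (∀ x ∈ feasibleSet c s, G x = gradientWithin (smoothedLog U υ) (feasibleSet c s) x) →
        (τ : ℝ) ≤ κ * ((m : ℝ) * max 1 (Real.log m)) →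
        ∃ (σ : RealRAM.State) (t : ℕ),
          RealRAM.Exec G τ prog (RealRAM.initState c s ρ z γ ξ) σ t ∧
          σ.output m ∈ feasibleSet c s ∧
          (∀ x ∈ feasibleSet c s,
            inner ℝ (x - σ.output m)
              (gradientWithin (smoothedLog U υ) (feasibleSet c s) (σ.output m) - γ -
                ρ • (σ.output m - z)) ≤ ξ) ∧
          (t : ℝ) ≤ C * ((m : ℝ) * max 1 (Real.log m)) *
            max 1 (Real.sqrt ((L + ρ) / ξ)) * max 1 (Real.log (1 / ξ)) := by
  -- The constant combines `10000000` from `runs_xUpdate`, the 2 from `2 ^ J ≤ 2 R`, and `5 + |κ|`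
  -- for one projection plus one oracle call.
  refine ⟨RealRAM.xUpdate, fun κ => ⟨20000000 * (5 + |κ|), ?_⟩⟩
  intro m c s β υ ρ L ξ U z γ G τ hm hc hs hυ hρ hξ hU hL hG hτ
  have hf := smoothConvexOn_objective hc z γ hυ hρ hU hL hG
  obtain ⟨J, hJ, hJ'⟩ := exists_le_four_pow ((L + ρ) / ξ)
  obtain ⟨σ, t, hexec, ht, x', hx', hst, hopt⟩ :=
    RealRAM.runs_xUpdate (τ := τ) hm hc hs hξ hf ((div_le_iff₀ hξ).mp hJ)
  have hout : σ.output m = x' := hst.vec_eq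
  refine ⟨σ, t, hexec, by rwa [hout], fun x hx => ?_, ?_⟩
  · have := hopt x hx
    rw [hout, ← hG x' hx']
    convert this using 2
    unfold objectiveGrad
    abel
  · set A : ℝ := (m : ℝ) * max 1 (Real.log m) with hA
    set R := max 1 (√((L + ρ) / ξ))
    have hA0 : 0 ≤ A := by positivity
    have hW : (RealRAM.workUnit m τ : ℝ) ≤ (5 + |κ|) * A := by
      have h1 : (m : ℝ) * (Nat.clog 2 (2 * m) + 1) ≤ m * (5 * max 1 (Real.log m)) := by
        gcongr
        exact clog_two_mul_le hm
      have h2 : κ * A ≤ |κ| * A := by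
        gcongr
        exact le_abs_self κ
      unfold RealRAM.workUnit
      push_cast
      linarith
    have ht' : (t : ℝ) ≤ 10000000 * (2 ^ J * RealRAM.workUnit m τ) := by exact_mod_cast ht
    calc (t : ℝ) ≤ 10000000 * (2 ^ J * RealRAM.workUnit m τ) := ht'
      _ ≤ 10000000 * (2 * R * ((5 + |κ|) * A)) := by gcongr
      _ = 20000000 * (5 + |κ|) * A * R * 1 := by ring
      -- The logarithmic factor enters only here, bounded below by 1.
      _ ≤ _ := by
        gcongr
        exact le_max_left _ _
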